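/- **Setting (abstract).** Let $U=\bigoplus_{p\in\mathbb Z}U_p$ be a $\mathbb Z$-graded unital associative ring with a decreasing exhaustive system of neighbourhoods of $0$ given by homogeneous additive subgroups $N^nU$ ($n\in\mathbb Z$), with $N^nU_p:=N^nU\cap U_p$, such that $(N^nU_p)\,U_q\subseteq N^{n-q}U_{p+q}$ and $U_p\,(N^nU_q)\subseteq N^nU_{p+q}$. Call it *almost canonical* if $N^nU_p=(U\,U_{\le -n})_p+N^{n+1}U_p$ for all $n,p$. Put $N_L^nU=N^nU$ and let $N_R^nU$ be the homogeneous subgroup with $N_R^{n}U_p=N^{n-p}U_p$. For $d\ge -1$ let $A_d=U_0/N^{d+1}U_0$, with quotient maps $u\mapsto[u]_d$ and projections $\pi_d\colon A_d\to A_{d-1}$. For a left $A_0$-module $W_0$ let $\Phi^L(W_0)=(U/N_L^1U)\otimes_{U_0}W_0$, a graded left $U$-module with degree $d$ part $\Phi^L(W_0)_d=(U/N^1_LU)_d\otimes_{U_0}W_0$. For homogeneous $\alpha,\beta\in U$ let $\alpha\circledast\beta=[\alpha\beta]_0\in A_0$ if $\deg\alpha+\deg\beta=0$ and $\alpha\circledast\beta=0$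 otherwise, and extend biadditively. Let $$\mathfrak A=(U/N_L^1U)\otimes_{U_0}A_0\otimes_{U_0}(U/N_R^1U),$$ which acts on $\Phi^L(W_0)$ by $(\alpha\otimes a\otimes\alpha')\star(\beta\otimes w)=\alpha\otimes a(\alpha'\circledast\beta)w$ and is an associative (possibly non-unital) ring under $(\alpha\otimes a\otimes\alpha')\star(\beta\otimes b\otimes\beta')=\alpha\otimes a(\alpha'\circledast\beta)b\otimes\beta'$. For $d\in\mathbb N$ let $\mathfrak A_d=(U/N_L^1U)_d\otimes_{U_0}A_0\otimes_{U_0}(U/N_R^1U)_{-d}$, a subring of $\mathfrak A$, and let $\mu_d\colon\mathfrak A_d\to A_d$, $\alpha\otimes[u]_0\otimes\beta\mapsto[\alpha u\beta]_d$. **Setting (vertex operator algebras).** Let $V=\bigoplus_{i\in\mathbb N}V_i$ be a vertex operator algebra of CFT type over $\mathbb C$ ($\dim V_i<\infty$, $\dim V_0=1$), with vacuum $\mathbf 1$ and conformal vector $\omega$. Let $U$ be the universal enveloping algebra of the Lie algebra $\mathfrak L(V)^f=V\otimes\mathbb C[t,t^{-1}]/\mathrm{Im}(L_{-1}\otimes\mathrm{id}+\mathrm{id}\otimes\frac{d}{dt})$,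 whose elements $a_{[i]}$ (the class of $a\otimes t^i$) have bracket $[a_{[i]},b_{[j]}]=\sum_{k\ge0}\binom ik(a_{(k)}b)_{[i+j-k]}$ and degree $\deg a-i-1$. Let $\widehat U=\bigoplus_p\varprojlim_n U_p/\big(\sum_{j\le-n}U_{p-j}U_j\big)$, and let $\mathscr U=\widehat U/\overline J$, where $\overline J$ is the (degreewise) closure of the two-sided ideal $J$ generated by $\mathbf 1_{[-1]}-1$ and the Jacobi relations $$\sum_{i\ge0}(-1)^i\binom\ell i\big(a_{[m+\ell-i]}b_{[n+i]}-(-1)^\ell b_{[n+\ell-i]}a_{[m+i]}\big)=\sum_{i\ge0}\binom mi(a_{(\ell+i)}b)_{[m+n-i]}$$ for $\ell,m,n\in\mathbb Z$ and $a,b\in V$. Then $\mathscr U$ is a graded ring with (quotient) neighbourhoods $N^n\mathscr U$ as above, and $A_d$, $\Phi^L$, $\mathfrak A_d$, $\mu_d$ for $V$ are those formed from $\mathscr U$. The rings $\mathfrak A_d$ ($d\in\mathbb N$) are said to have *strong identity elements* if every $\mathfrak A_d$ has an identity element $\mathscr I_d$ that acts as the identity on $\Phi^L(A_0)_d$. **Theorem.**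 (a) Suppose that either $U$ is a graded ring as in the abstract setting whose neighbourhoods are almost canonical, or $U=\mathscr U$ for a vertex operator algebra $V$ of CFT type. Let $d\in\mathbb N$. The sequence $$\mathfrak A_d\xrightarrow{\ \mu_d\ }A_d\xrightarrow{\ \pi_d\ }A_{d-1}\longrightarrow0$$ is exact. If $\mathfrak A_d$ has an identity element, then $\mu_d$ is injective and the sequence splits: there is a ring isomorphism $A_d\cong\mathfrak A_d\times A_{d-1}$ under which $\mu_d$ is the inclusion of the first factor and $\pi_d$ is the projection to the second. In particular, if $\mathfrak A_j$ has an identity element for every $0\le j\le d$, then $A_d\cong\mathfrak A_d\oplus\mathfrak A_{d-1}\oplus\cdots\oplus\mathfrak A_0$ as rings. (b) Let $V$ be a vertex operator algebra of CFT type for which the rings $\mathfrak A_d$, $d\in\mathbb N$, have strong identity elements. Let $W_0$ be an $A_0$-module on which $L_0=\omega_{[1]}$ acts as a scalar $c_W\in\mathbb C$, and let $W=\Phi^L(W_0)$. Then there is no non-zero proper submodule $Z\subset W$ such that $c_Z-c_W$ is a positive integer for every eigenvalue $c_Z$ of $L_0$ on $Z$. -/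

import Mathlib

open scoped DirectSum TensorProduct

universe u v w

noncomputable section

namespace ModeAlg



/-- A `ℤ`-graded (unital, associative) ring `U = ⨁ U_p` together with a system of neighbourhoods of
`0` given by homogeneous additive subgroups `N^n U` such that
`(N^n U_p) U_q ⊆ N^(n-q) U_(p+q)` and `U_p (N^n U_q) ⊆ N^n U_(p+q)`. -/
structure SeminormedGradedRing where
  carrier : Type u
  [ring : Ring carrier]
  deg : ℤ → AddSubgroup carrier
  [graded : GradedRing deg]
  nbhd : ℤ → AddSubgroup carrier
  nbhd_anti : ∀ n, nbhd (n + 1) ≤ nbhd n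
  nbhd_exhaust : ∀ x, ∃ n, x ∈ nbhd n
  nbhd_homog : ∀ n x, x ∈ nbhd n → ∀ p, (DirectSum.decompose deg x p : carrier) ∈ nbhd n
  nbhd_mul : ∀ n p q x y, x ∈ nbhd n → x ∈ deg p → y ∈ deg q → x * y ∈ nbhd (n - q)
  mul_nbhd : ∀ n p q x y, x ∈ deg p → y ∈ nbhd n → y ∈ deg q → x * y ∈ nbhd n

attribute [instance] SeminormedGradedRing.ring SeminormedGradedRing.graded

namespace SeminormedGradedRing

variable (U : SeminormedGradedRing.{u})

/-- The canonical neighbourhood `U U_{≤ -n}`. -/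
def canonicalNbhd (n : ℤ) : AddSubgroup U.carrier :=
  AddSubgroup.closure {z | ∃ x y : U.carrier, ∃ j ≤ -n, y ∈ U.deg j ∧ z = x * y}

/-- The seminorm is almost canonical: `N^n U_p = (U U_{≤ -n})_p + N^(n+1) U_p`. -/
def AlmostCanonical : Prop :=
  ∀ n p : ℤ, U.nbhd n ⊓ U.deg p = (U.canonicalNbhd n ⊓ U.deg p) ⊔ (U.nbhd (n + 1) ⊓ U.deg p)

/-- The left neighbourhoods `N_L^n U`. -/
abbrev nbhdL (n : ℤ) : AddSubgroup U.carrier := U.nbhd n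

/-- The right neighbourhoods `N_R^n U`, determined by `N_R^(n+p) U_p = N_L^n U_p`. -/
def nbhdR (n : ℤ) : AddSubgroup U.carrier where
  carrier := {x | ∀ p, (DirectSum.decompose U.deg x p : U.carrier) ∈ U.nbhd (n - p)}
  zero_mem' p := by simp
  add_mem' {x y} hx hy p := by
    simpa [DirectSum.decompose_add] using add_mem (hx p) (hy p)
  neg_mem' {x} hx p := by
    rw [DirectSum.decompose_neg]
    exact neg_mem (hx p)

/-! ### Zhu algebras -/

/-- `N^n U_0`, a two-sided ideal of `U_0`. -/
def zhuIdeal (n : ℤ) : Ideal (U.deg 0) where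
  carrier := {x | (x : U.carrier) ∈ U.nbhd n}
  zero_mem' := (U.nbhd n).zero_mem
  add_mem' hx hy := (U.nbhd n).add_mem hx hy
  smul_mem' c x hx := U.mul_nbhd n 0 0 _ _ c.2 hx x.2

instance (n : ℤ) : (U.zhuIdeal n).IsTwoSided where
  mul_mem_of_left {a} b ha := by
    have := U.nbhd_mul n 0 0 _ _ ha a.2 b.2
    rwa [sub_zero] at this

theorem zhuIdeal_anti (n : ℤ) : U.zhuIdeal (n + 1) ≤ U.zhuIdeal n :=
  fun _ hx => U.nbhd_anti n hx

/-- The `d`-th Zhu algebra `A_d = U_0 / N^(d+1) U_0`. -/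
def Zhu (d : ℤ) : Type u := U.deg 0 ⧸ U.zhuIdeal (d + 1)

instance (d : ℤ) : Ring (U.Zhu d) := inferInstanceAs (Ring (U.deg 0 ⧸ U.zhuIdeal (d + 1)))

/-- The quotient map `U_0 → A_d`, `α ↦ [α]_d`. -/
def zhuMk (d : ℤ) : U.deg 0 →+* U.Zhu d := Ideal.Quotient.mk (U.zhuIdeal (d + 1))

theorem zhuMk_surjective (d : ℤ) : Function.Surjective (U.zhuMk d) :=
  Ideal.Quotient.mk_surjective

theorem zhuMk_eq_zero {d : ℤ} {u : U.deg 0} (h : (u : U.carrier) ∈ U.nbhd (d + 1)) :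
    U.zhuMk d u = 0 :=
  Ideal.Quotient.eq_zero_iff_mem.2 h

/-- The projection `π_d : A_d → A_{d-1}`. -/
def zhuProj (d : ℤ) : U.Zhu d →+* U.Zhu (d - 1) :=
  Ideal.Quotient.factor (S := U.zhuIdeal (d + 1)) (T := U.zhuIdeal (d - 1 + 1)) (by
    have h := U.zhuIdeal_anti d
    rwa [show d - 1 + 1 = d by ring])

theorem zhuProj_mk (d : ℤ) (u : U.deg 0) : U.zhuProj d (U.zhuMk d u) = U.zhuMk (d - 1) u := rfl

/-- The projection `U → U_p`. -/
def comp (p : ℤ) : U.carrier →+ U.deg p :=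
  (DFinsupp.evalAddMonoidHom p).comp (DirectSum.decomposeAddEquiv U.deg).toAddMonoidHom

theorem comp_apply (p : ℤ) (x : U.carrier) : U.comp p x = DirectSum.decompose U.deg x p := rfl

variable {U} in
theorem comp_left {p q r : ℤ} {x : U.carrier} (hx : x ∈ U.deg p) (y : U.carrier)
    (h : p + q = r) : (U.comp r (x * y) : U.carrier) = x * U.comp q y := by
  subst h
  exact DirectSum.coe_decompose_mul_add_of_left_mem U.deg hx

variable {U} in
theorem comp_right {p q r : ℤ} {y : U.carrier} (hy : y ∈ U.deg q) (x : U.carrier)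
    (h : p + q = r) : (U.comp r (x * y) : U.carrier) = U.comp p x * y := by
  subst h
  exact DirectSum.coe_decompose_mul_add_of_right_mem U.deg hy

variable {U} in
theorem comp_of_mem {p : ℤ} {x : U.carrier} (hx : x ∈ U.deg p) : (U.comp p x : U.carrier) = x :=
  DirectSum.decompose_of_mem_same U.deg hx

/-- The pairing `α ⊛ β ∈ A_0`: for homogeneous `α`, `β` it is `[α β]_0` if `deg α + deg β = 0` and
`0` otherwise; in general it is the class of the degree `0` component of `α β`. -/
def ostar (α β : U.carrier) : U.Zhu 0 := U.zhuMk 0 (U.comp 0 (α * β))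

variable {U}

theorem ostar_add_left (α α' β : U.carrier) :
    U.ostar (α + α') β = U.ostar α β + U.ostar α' β := by
  simp [ostar, add_mul]

theorem ostar_add_right (α β β' : U.carrier) :
    U.ostar α (β + β') = U.ostar α β + U.ostar α β' := by
  simp [ostar, mul_add]

theorem ostar_zero_left (β : U.carrier) : U.ostar 0 β = 0 := by simp [ostar]

theorem ostar_zero_right (α : U.carrier) : U.ostar α 0 = 0 := by simp [ostar]

theorem ostar_zsmul_left (n : ℤ) (α β : U.carrier) : U.ostar (n • α) β = n • U.ostar α β :=
  map_zsmul (AddMonoidHom.mk' (fun α => U.ostar α β) fun a b => ostar_add_left a b β) n α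

theorem ostar_mul_middle (α γ β : U.carrier) : U.ostar (α * γ) β = U.ostar α (γ * β) := by
  simp [ostar, mul_assoc]

theorem ostar_mul_left (v : U.deg 0) (α β : U.carrier) :
    U.ostar (v * α) β = U.zhuMk 0 v * U.ostar α β := by
  rw [ostar, ostar, ← map_mul]
  congr 1
  apply Subtype.ext
  rw [mul_assoc, comp_left v.2 _ (zero_add 0)]
  rfl

theorem ostar_mul_right (v : U.deg 0) (α β : U.carrier) :
    U.ostar α (β * v) = U.ostar α β * U.zhuMk 0 v := by
  rw [ostar, ostar, ← map_mul]
  congr 1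
  apply Subtype.ext
  rw [← mul_assoc, comp_right v.2 _ (zero_add 0)]
  rfl

theorem ostar_of_nbhdR {α : U.carrier} (hα : α ∈ U.nbhdR 1) (β : U.carrier) :
    U.ostar α β = 0 := by
  refine DirectSum.Decomposition.inductionOn U.deg (ostar_zero_right α) ?_ ?_ β
  · intro q b
    refine zhuMk_eq_zero _ ?_
    rw [comp_right b.2 α (p := -q) (by ring)]
    have := U.nbhd_mul _ _ _ _ _ (hα (-q)) (U.comp (-q) α).2 b.2
    rwa [show (1 : ℤ) - -q - q = 0 + 1 by ring] at this
  · intro b b' h h'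
    rw [ostar_add_right, h, h', add_zero]

theorem ostar_of_nbhdL {β : U.carrier} (hβ : β ∈ U.nbhdL 1) (α : U.carrier) :
    U.ostar α β = 0 := by
  refine DirectSum.Decomposition.inductionOn U.deg (ostar_zero_left β) ?_ ?_ α
  · intro p a
    refine zhuMk_eq_zero _ ?_
    rw [comp_left a.2 β (q := -p) (by ring)]
    exact U.mul_nbhd _ _ _ _ _ a.2 (U.nbhd_homog _ _ hβ (-p)) (U.comp (-p) β).2
  · intro b b' h h'
    rw [ostar_add_left, h, h', add_zero]

/-! ### Induced modules -/

variable (U)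

section PhiL

variable (W : Type w) [AddCommGroup W] [Module (U.Zhu 0) W]

/-- The relations presenting `(U / N_L^1 U) ⊗_{U_0} W` as a quotient of `U ⊗_ℤ W`. -/
def phiLGen : Set (U.carrier ⊗[ℤ] W) :=
  {x | ∃ α ∈ U.nbhdL 1, ∃ m : W, x = α ⊗ₜ m} ∪
  {x | ∃ (α : U.carrier) (a : U.deg 0) (m : W),
    x = (α * a) ⊗ₜ m - α ⊗ₜ (U.zhuMk 0 a • m)}

/-- The generalized Verma module `Φ^L(W) = (U / N_L^1 U) ⊗_{U_0} W`, a left `U`-module. The set of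
relations is stable under left multiplication by `U`, so that the `U`-submodule it spans is also the
additive subgroup it generates. -/
def PhiL : Type (max u w) := (U.carrier ⊗[ℤ] W) ⧸ Submodule.span U.carrier (U.phiLGen W)

instance : AddCommGroup (U.PhiL W) :=
  inferInstanceAs (AddCommGroup ((U.carrier ⊗[ℤ] W) ⧸ Submodule.span U.carrier (U.phiLGen W)))

instance : Module U.carrier (U.PhiL W) :=
  inferInstanceAs
    (Module U.carrier ((U.carrier ⊗[ℤ] W) ⧸ Submodule.span U.carrier (U.phiLGen W)))

variable {W} in
/-- The element `α ⊗ m` of `Φ^L(W)`. -/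
def phiLTmul (α : U.carrier) (m : W) : U.PhiL W :=
  Submodule.Quotient.mk (p := Submodule.span U.carrier (U.phiLGen W)) (α ⊗ₜ m)

/-- The degree `d` part `Φ^L(W)_d = (U / N_L^1 U)_d ⊗_{U_0} W`. -/
def phiLDeg (d : ℤ) : AddSubgroup (U.PhiL W) :=
  AddSubgroup.closure {x | ∃ α ∈ U.deg d, ∃ m : W, x = U.phiLTmul α m}

variable {U W}

/-- A biadditive map induces an additive map on the tensor product over `ℤ`. -/
def addLift {M N P : Type*} [AddCommGroup M] [AddCommGroup N] [AddCommGroup P]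
    (f : M →+ N →+ P) : M ⊗[ℤ] N →+ P :=
  TensorProduct.liftAddHom f fun n m x => by
    rw [map_zsmul, map_zsmul]
    rfl

theorem addLift_tmul {M N P : Type*} [AddCommGroup M] [AddCommGroup N] [AddCommGroup P]
    (f : M →+ N →+ P) (m : M) (x : N) : addLift f (m ⊗ₜ x) = f m x := rfl

theorem phiLGen_smul (γ : U.carrier) {x : U.carrier ⊗[ℤ] W} (hx : x ∈ U.phiLGen W) :
    γ • x ∈ AddSubgroup.closure (U.phiLGen W) := by
  rcases hx with ⟨α, hα, m, rfl⟩ | ⟨α, a, m, rfl⟩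
  · rw [TensorProduct.smul_tmul']
    refine DirectSum.Decomposition.inductionOn U.deg
      (motive := fun γ => (γ • α) ⊗ₜ[ℤ] m ∈ AddSubgroup.closure (U.phiLGen W)) ?_ ?_ ?_ γ
    · simp
    · intro p c
      apply AddSubgroup.subset_closure
      left
      refine ⟨_, ?_, m, rfl⟩
      classical
      rw [smul_eq_mul, ← DirectSum.sum_support_decompose U.deg α, Finset.mul_sum]
      exact sum_mem fun i _ => U.mul_nbhd _ _ _ _ _ c.2 (U.nbhd_homog _ _ hα i) (SetLike.coe_mem _)
    · intro b c hb hc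
      rw [add_smul, TensorProduct.add_tmul]
      exact add_mem hb hc
  · apply AddSubgroup.subset_closure
    right
    refine ⟨γ * α, a, m, ?_⟩
    simp [smul_sub, TensorProduct.smul_tmul', mul_assoc]

/-- An additive map on `U ⊗_ℤ W` that kills the relations of `Φ^L(W)` descends to `Φ^L(W)`. -/
def phiLLift {P : Type*} [AddCommGroup P] (φ : U.carrier ⊗[ℤ] W →+ P)
    (h1 : ∀ α ∈ U.nbhdL 1, ∀ m, φ (α ⊗ₜ m) = 0)
    (h2 : ∀ (α : U.carrier) (a : U.deg 0) (m : W),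
      φ ((α * a) ⊗ₜ m) = φ (α ⊗ₜ (U.zhuMk 0 a • m))) : U.PhiL W →+ P :=
  QuotientAddGroup.lift (Submodule.span U.carrier (U.phiLGen W)).toAddSubgroup φ <| by
    have h0 : AddSubgroup.closure (U.phiLGen W) ≤ φ.ker := by
      rw [AddSubgroup.closure_le]
      rintro x (⟨α, hα, m, rfl⟩ | ⟨α, a, m, rfl⟩)
      · exact h1 α hα m
      · change φ _ = 0
        rw [map_sub, h2, sub_self]
    intro x hx
    have key : ∀ γ : U.carrier, φ (γ • x) = 0 := by
      refine Submodule.span_induction (p := fun x _ => ∀ γ : U.carrier, φ (γ • x) = 0)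
        ?_ ?_ ?_ ?_ hx
      · intro x hx γ
        exact h0 (phiLGen_smul γ hx)
      · simp
      · intro x y _ _ hx hy γ
        rw [smul_add, map_add, hx, hy, add_zero]
      · intro δ x _ hx γ
        rw [smul_smul, hx]
    simpa using key 1

theorem phiLLift_tmul {P : Type*} [AddCommGroup P] (φ : U.carrier ⊗[ℤ] W →+ P) (h1) (h2)
    (α : U.carrier) (m : W) : phiLLift φ h1 h2 (U.phiLTmul α m) = φ (α ⊗ₜ m) := rfl

theorem smul_phiLTmul (γ α : U.carrier) (m : W) : γ • U.phiLTmul α m = U.phiLTmul (γ * α) m := rfl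

theorem phiL_induction {P : U.PhiL W → Prop} (x : U.PhiL W) (h0 : P 0)
    (ht : ∀ α m, P (U.phiLTmul α m)) (ha : ∀ x y, P x → P y → P (x + y)) : P x := by
  obtain ⟨x, rfl⟩ := Submodule.Quotient.mk_surjective _ x
  induction x using TensorProduct.induction_on with
  | zero => exact h0
  | tmul α m => exact ht α m
  | add x y hx hy => exact ha _ _ hx hy

theorem phiLTmul_mul (α : U.carrier) (a : U.deg 0) (m : W) :
    U.phiLTmul (α * a) m = U.phiLTmul α (U.zhuMk 0 a • m) :=
  (Submodule.Quotient.eq _).2 (Submodule.subset_span (Or.inr ⟨α, a, m, rfl⟩))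

theorem phiLTmul_nbhd {α : U.carrier} (hα : α ∈ U.nbhdL 1) (m : W) : U.phiLTmul α m = 0 :=
  (Submodule.Quotient.mk_eq_zero _).2 (Submodule.subset_span (Or.inl ⟨α, hα, m, rfl⟩))

variable {W' : Type*} [AddCommGroup W'] [Module (U.Zhu 0) W']

theorem phiLTmul_add_right (α : U.carrier) (m m' : W) :
    U.phiLTmul α (m + m') = U.phiLTmul α m + U.phiLTmul α m' :=
  congrArg (Submodule.Quotient.mk (p := Submodule.span U.carrier (U.phiLGen W)))
    (TensorProduct.tmul_add α m m')

theorem phiLTmul_add_left (α α' : U.carrier) (m : W) :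
    U.phiLTmul (α + α') m = U.phiLTmul α m + U.phiLTmul α' m :=
  congrArg (Submodule.Quotient.mk (p := Submodule.span U.carrier (U.phiLGen W)))
    (TensorProduct.add_tmul α α' m)

theorem phiLTmul_zero_right (α : U.carrier) : U.phiLTmul α (0 : W) = 0 :=
  congrArg (Submodule.Quotient.mk (p := Submodule.span U.carrier (U.phiLGen W)))
    (TensorProduct.tmul_zero W α)

theorem phiLTmul_zero_left (m : W) : U.phiLTmul (0 : U.carrier) m = 0 :=
  congrArg (Submodule.Quotient.mk (p := Submodule.span U.carrier (U.phiLGen W)))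
    (TensorProduct.zero_tmul U.carrier m)

/-- The functoriality of `Φ^L`. -/
def phiLMap (f : W →ₗ[U.Zhu 0] W') : U.PhiL W →+ U.PhiL W' :=
  phiLLift (addLift
      { toFun := fun α =>
          { toFun := fun m => U.phiLTmul α (f m)
            map_zero' := by simp [phiLTmul_zero_right]
            map_add' := by simp [phiLTmul_add_right] }
        map_zero' := by ext; simp [phiLTmul_zero_left]
        map_add' := fun α β => by ext; simp [phiLTmul_add_left] })
    (fun α hα m => phiLTmul_nbhd hα _)
    (fun α a m => by
      change U.phiLTmul (α * a) (f m) = U.phiLTmul α (f (U.zhuMk 0 a • m))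
      rw [phiLTmul_mul, map_smul])

theorem phiLMap_tmul (f : W →ₗ[U.Zhu 0] W') (α : U.carrier) (m : W) :
    phiLMap f (U.phiLTmul α m) = U.phiLTmul α (f m) := rfl

end PhiL

/-! ### The mode transition algebra -/

/-- The relations presenting `A_0 ⊗_{U_0} (U / N_R^1 U)` as a quotient of `A_0 ⊗_ℤ U`. -/
def phiRGen : Set (U.Zhu 0 ⊗[ℤ] U.carrier) :=
  {x | ∃ (a : U.Zhu 0), ∃ β ∈ U.nbhdR 1, x = a ⊗ₜ β} ∪
  {x | ∃ (a : U.Zhu 0) (b : U.deg 0) (β : U.carrier),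
    x = (a * U.zhuMk 0 b) ⊗ₜ β - a ⊗ₜ ((b : U.carrier) * β)}

/-- The right induced module `Φ^R(A_0) = A_0 ⊗_{U_0} (U / N_R^1 U)`, as a left `A_0`-module. -/
def PhiRZhu : Type u :=
  (U.Zhu 0 ⊗[ℤ] U.carrier) ⧸ Submodule.span (U.Zhu 0) U.phiRGen

instance : AddCommGroup U.PhiRZhu :=
  inferInstanceAs
    (AddCommGroup ((U.Zhu 0 ⊗[ℤ] U.carrier) ⧸ Submodule.span (U.Zhu 0) U.phiRGen))

instance : Module (U.Zhu 0) U.PhiRZhu :=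
  inferInstanceAs
    (Module (U.Zhu 0) ((U.Zhu 0 ⊗[ℤ] U.carrier) ⧸ Submodule.span (U.Zhu 0) U.phiRGen))

/-- The element `a ⊗ β` of `Φ^R(A_0)`. -/
def phiRTmul (a : U.Zhu 0) (β : U.carrier) : U.PhiRZhu :=
  Submodule.Quotient.mk (p := Submodule.span (U.Zhu 0) U.phiRGen) (a ⊗ₜ β)

/-- The mode transition algebra
`𝔄 = Φ^L(Φ^R(A_0)) = (U / N_L^1 U) ⊗_{U_0} A_0 ⊗_{U_0} (U / N_R^1 U)`. -/
def MTA : Type u := U.PhiL U.PhiRZhu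

instance : AddCommGroup U.MTA := inferInstanceAs (AddCommGroup (U.PhiL U.PhiRZhu))

/-- The element `α ⊗ a ⊗ β` of `𝔄`. -/
def mtaTmul (α : U.carrier) (a : U.Zhu 0) (β : U.carrier) : U.MTA :=
  U.phiLTmul α (U.phiRTmul a β)

variable {U}

section Star

variable {W : Type w} [AddCommGroup W] [Module (U.Zhu 0) W]

/-- For `β ∈ U` and `m ∈ W`, the `A_0`-linear map `Φ^R(A_0) → W`, `a ⊗ α' ↦ a (α' ⊛ β) m`. -/
def pair (β : U.carrier) (m : W) : U.PhiRZhu →ₗ[U.Zhu 0] W :=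
  Submodule.liftQ (Submodule.span (U.Zhu 0) U.phiRGen)
    (TensorProduct.AlgebraTensorModule.lift
      (LinearMap.mk₂' (U.Zhu 0) ℤ (fun (a : U.Zhu 0) (α' : U.carrier) => a • (U.ostar α' β • m))
        (fun a b c => add_smul _ _ _) (fun r a c => by rw [smul_eq_mul, mul_smul])
        (fun a b c => by rw [ostar_add_left, add_smul, smul_add])
        (fun n a c => by rw [ostar_zsmul_left, smul_assoc, smul_comm]) :
        U.Zhu 0 →ₗ[U.Zhu 0] U.carrier →ₗ[ℤ] W))
    (by
      rw [Submodule.span_le]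
      rintro x (⟨a, α', h, rfl⟩ | ⟨a, b, α', rfl⟩)
      · simp [ostar_of_nbhdR h]
      · simp [ostar_mul_left, mul_smul])

theorem pair_tmul (β : U.carrier) (m : W) (a : U.Zhu 0) (α' : U.carrier) :
    pair β m (U.phiRTmul a α') = a • (U.ostar α' β • m) := rfl

theorem phiR_induction {P : U.PhiRZhu → Prop} (x : U.PhiRZhu) (h0 : P 0)
    (ht : ∀ a β, P (U.phiRTmul a β)) (ha : ∀ x y, P x → P y → P (x + y)) : P x := by
  obtain ⟨x, rfl⟩ := Submodule.Quotient.mk_surjective _ x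
  induction x using TensorProduct.induction_on with
  | zero => exact h0
  | tmul a β => exact ht a β
  | add x y hx hy => exact ha _ _ hx hy

theorem mta_induction {P : U.MTA → Prop} (x : U.MTA) (h0 : P 0)
    (ht : ∀ α a β, P (U.mtaTmul α a β)) (ha : ∀ x y, P x → P y → P (x + y)) : P x := by
  refine phiL_induction (U := U) (W := U.PhiRZhu) (P := P) x h0 (fun α m => ?_) ha
  refine phiR_induction (P := fun m => P (U.phiLTmul α m)) m ?_ (fun a β => ht α a β) fun x y hx hy => ?_
  · rw [phiLTmul_zero_right]; exact h0
  · rw [phiLTmul_add_right]; exact ha _ _ hx hy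

theorem mta_hom_ext {P : Type*} [AddCommGroup P] {f g : U.MTA →+ P}
    (h : ∀ α a β, f (U.mtaTmul α a β) = g (U.mtaTmul α a β)) : f = g := by
  ext x
  refine mta_induction (P := fun x => f x = g x) x (by simp) h fun x y hx hy => ?_
  rw [map_add, map_add, hx, hy]

/-- The map `𝔄 → Φ^L(W)`, `x ↦ x ⋆ (β ⊗ m)`. -/
def starAux (β : U.carrier) (m : W) : U.MTA →+ U.PhiL W := phiLMap (pair β m)

theorem starAux_tmul (β : U.carrier) (m : W) (α : U.carrier) (a : U.Zhu 0) (α' : U.carrier) :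
    starAux β m (U.mtaTmul α a α') = U.phiLTmul α (a • (U.ostar α' β • m)) := rfl

/-- The map `Φ^L(W) → Hom(𝔄, Φ^L(W))`, `y ↦ (x ↦ x ⋆ y)`. -/
def starHom : U.PhiL W →+ U.MTA →+ U.PhiL W :=
  phiLLift (addLift
      { toFun := fun β =>
          { toFun := fun m => starAux β m
            map_zero' := mta_hom_ext fun α a α' => by
              simp [starAux_tmul, phiLTmul_zero_right]
            map_add' := fun m m' => mta_hom_ext fun α a α' => by
              simp [starAux_tmul, phiLTmul_add_right] }
        map_zero' := by
          ext1 m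
          exact mta_hom_ext fun α a α' => by
            simp [starAux_tmul, ostar_zero_right, phiLTmul_zero_right]
        map_add' := fun β β' => by
          ext1 m
          exact mta_hom_ext fun α a α' => by
            simp [starAux_tmul, ostar_add_right, add_smul, phiLTmul_add_right] })
    (fun β hβ m => mta_hom_ext fun α a α' => by
      change U.phiLTmul α (a • (U.ostar α' β • m)) = 0
      rw [ostar_of_nbhdL hβ, zero_smul, smul_zero, phiLTmul_zero_right])
    (fun β b m => mta_hom_ext fun α a α' => by
      change U.phiLTmul α (a • (U.ostar α' (β * b) • m)) =
        U.phiLTmul α (a • (U.ostar α' β • U.zhuMk 0 b • m))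
      rw [ostar_mul_right, mul_smul])

/-- The action `⋆` of `𝔄` on `Φ^L(W)`. -/
def star (x : U.MTA) (y : U.PhiL W) : U.PhiL W := starHom y x

/-- `(α ⊗ a ⊗ α') ⋆ (β ⊗ m) = α ⊗ a (α' ⊛ β) m`. -/
theorem star_tmul (α : U.carrier) (a : U.Zhu 0) (α' β : U.carrier) (m : W) :
    star (U.mtaTmul α a α') (U.phiLTmul β m) = U.phiLTmul α (a • (U.ostar α' β • m)) := rfl

theorem star_add (x : U.MTA) (y y' : U.PhiL W) : star x (y + y') = star x y + star x y' := by
  simp [star]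

theorem add_star (x x' : U.MTA) (y : U.PhiL W) : star (x + x') y = star x y + star x' y := by
  simp [star]

theorem star_zero (x : U.MTA) : star x (0 : U.PhiL W) = 0 := by simp [star]

theorem zero_star (y : U.PhiL W) : star (0 : U.MTA) y = 0 := by simp [star]

end Star

instance : Mul U.MTA := ⟨fun x y => star (W := U.PhiRZhu) x y⟩

/-- `(α ⊗ a ⊗ α') ⋆ (β ⊗ b ⊗ β') = α ⊗ a (α' ⊛ β) b ⊗ β'`. -/
theorem mtaTmul_mul (α : U.carrier) (a : U.Zhu 0) (α' β : U.carrier) (b : U.Zhu 0)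
    (β' : U.carrier) :
    U.mtaTmul α a α' * U.mtaTmul β b β' = U.mtaTmul α (a * (U.ostar α' β * b)) β' := rfl

theorem mta_add_mul (x x' y : U.MTA) : (x + x') * y = x * y + x' * y :=
  add_star (W := U.PhiRZhu) x x' y

theorem mta_mul_add (x y y' : U.MTA) : x * (y + y') = x * y + x * y' :=
  star_add (W := U.PhiRZhu) x y y'

theorem mta_zero_mul (y : U.MTA) : (0 : U.MTA) * y = 0 := zero_star (W := U.PhiRZhu) y

theorem mta_mul_zero (x : U.MTA) : x * (0 : U.MTA) = 0 := star_zero (W := U.PhiRZhu) x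

theorem mul_star {W : Type w} [AddCommGroup W] [Module (U.Zhu 0) W] (x y : U.MTA)
    (z : U.PhiL W) : star (x * y) z = star x (star y z) := by
  refine mta_induction (P := fun x => star (x * y) z = star x (star y z)) x ?_ ?_ ?_
  · rw [mta_zero_mul, zero_star, zero_star]
  · intro α a α'
    refine mta_induction (P := fun y => star (U.mtaTmul α a α' * y) z =
      star (U.mtaTmul α a α') (star y z)) y ?_ ?_ ?_
    · rw [mta_mul_zero, zero_star, star_zero]
    · intro β b β'
      refine phiL_induction (P := fun z => star (U.mtaTmul α a α' * U.mtaTmul β b β') z =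
        star (U.mtaTmul α a α') (star (U.mtaTmul β b β') z)) z ?_ ?_ ?_
      · simp only [star_zero]
      · intro γ m
        rw [mtaTmul_mul, star_tmul, star_tmul, star_tmul]
        simp only [mul_smul]
      · intro z z' h h'
        simp only [star_add, h, h']
    · intro y y' h h'
      rw [mta_mul_add, add_star, add_star, h, h', star_add]
  · intro x x' h h'
    rw [mta_add_mul, add_star, add_star, h, h']

instance : NonUnitalRing U.MTA :=
  { (inferInstance : AddCommGroup U.MTA), (inferInstance : Mul U.MTA) with
    left_distrib := mta_mul_add
    right_distrib := mta_add_mul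
    zero_mul := mta_zero_mul
    mul_zero := mta_mul_zero
    mul_assoc := fun x y z => mul_star (W := U.PhiRZhu) x y z }

variable (U)

/-- The bigraded piece `𝔄_{p,q} = (U / N_L^1 U)_p ⊗ A_0 ⊗ (U / N_R^1 U)_q`. -/
def mtaBideg (p q : ℤ) : AddSubgroup U.MTA :=
  AddSubgroup.closure {x | ∃ α ∈ U.deg p, ∃ (a : U.Zhu 0), ∃ β ∈ U.deg q, x = U.mtaTmul α a β}

/-- The `d`-th mode transition algebra `𝔄_d = 𝔄_{d,-d}`. -/
def MTAd (d : ℕ) : NonUnitalSubring U.MTA :=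
  { U.mtaBideg d (-d) with
    mul_mem' := by
      intro x y hx hy
      change x * y ∈ U.mtaBideg d (-d)
      refine AddSubgroup.closure_induction₂ (p := fun x y _ _ => x * y ∈ U.mtaBideg d (-d))
        ?_ ?_ ?_ ?_ ?_ ?_ ?_ hx hy
      · rintro _ _ ⟨α, hα, a, α', hα', rfl⟩ ⟨β, hβ, b, β', hβ', rfl⟩
        rw [mtaTmul_mul]
        exact AddSubgroup.subset_closure ⟨_, hα, _, _, hβ', rfl⟩
      · intro x _; rw [zero_mul]; exact zero_mem _
      · intro x _; rw [mul_zero]; exact zero_mem _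
      · intro x y z _ _ _ h h'; rw [add_mul]; exact add_mem h h'
      · intro x y z _ _ _ h h'; rw [mul_add]; exact add_mem h h'
      · intro x y _ _ h; rw [neg_mul]; exact neg_mem h
      · intro x y _ _ h; rw [mul_neg]; exact neg_mem h }

/-- `e` is an identity element of the ring `𝔄_d`. -/
def IsIdentity (d : ℕ) (e : U.MTAd d) : Prop := ∀ x : U.MTAd d, e * x = x ∧ x * e = x

/-- `𝔄_d` admits an identity element. -/
def HasIdentity (d : ℕ) : Prop := ∃ e : U.MTAd d, U.IsIdentity d e

/-- Every `𝔄_d` admits a strong identity element: an identity element that acts as the identity on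
`Φ^L(A_0)_d`, i.e. such that the homomorphism `𝔄_d → End(Φ^L(A_0)_d)` is unital. -/
def HasStrongIdentities : Prop :=
  ∀ d : ℕ, ∃ e : U.MTAd d, U.IsIdentity d e ∧
    ∀ y ∈ U.phiLDeg (U.Zhu 0) d, star (e : U.MTA) y = y

/-! ### The map `μ_d` -/

variable {U}

/-- For `α, β ∈ U`, the map `A_0 → A_d`, `[u]_0 ↦ [α_d u β_{-d}]_d`. -/
def muMid (d : ℤ) (α β : U.carrier) : U.Zhu 0 →+ U.Zhu d :=
  QuotientAddGroup.lift (U.zhuIdeal (0 + 1)).toAddSubgroup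
    { toFun := fun u => U.zhuMk d (U.comp 0 (U.comp d α * (u * U.comp (-d) β)))
      map_zero' := by simp
      map_add' := fun x y => by simp [add_mul, mul_add] }
    (by
      intro u hu
      refine zhuMk_eq_zero _ ?_
      rw [comp_left (U.comp d α).2 _ (q := -d) (by ring),
        comp_right (U.comp (-d) β).2 _ (p := 0) (by ring), comp_of_mem u.2]
      have h := U.nbhd_mul _ _ _ _ _ hu u.2 (U.comp (-d) β).2
      have h' := U.mul_nbhd _ _ (0 + -d) _ _ (U.comp d α).2 h
        (SetLike.mul_mem_graded u.2 (U.comp (-d) β).2)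
      rwa [show (0 + 1 - -d : ℤ) = d + 1 by ring] at h')

theorem muMid_mk (d : ℤ) (α β : U.carrier) (u : U.deg 0) :
    muMid d α β (U.zhuMk 0 u) = U.zhuMk d (U.comp 0 (U.comp d α * (u * U.comp (-d) β))) := rfl

/-- For `α ∈ U`, the map `A_0 × U → A_d`, `([u]_0, β) ↦ [α_d u β_{-d}]_d`. -/
def muPre (d : ℤ) (α : U.carrier) : U.Zhu 0 →+ U.carrier →+ U.Zhu d where
  toFun a :=
    { toFun := fun β => muMid d α β a
      map_zero' := by
        obtain ⟨u, rfl⟩ := U.zhuMk_surjective _ a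
        simp [muMid_mk]
      map_add' := fun β β' => by
        obtain ⟨u, rfl⟩ := U.zhuMk_surjective _ a
        simp [muMid_mk, mul_add] }
  map_zero' := by ext; simp
  map_add' _ _ := by ext; simp

/-- For `α ∈ U`, the map `Φ^R(A_0) → A_d`, `[u]_0 ⊗ β ↦ [α_d u β_{-d}]_d`. -/
def muRight (d : ℤ) (α : U.carrier) : U.PhiRZhu →+ U.Zhu d :=
  QuotientAddGroup.lift (Submodule.span (U.Zhu 0) U.phiRGen).toAddSubgroup
    (addLift (muPre d α))
    (by
      intro x hx
      set φ := addLift (muPre d α) with hφ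
      have hφt : ∀ (a : U.Zhu 0) (β : U.carrier), φ (a ⊗ₜ β) = muMid d α β a := fun _ _ => rfl
      have key : ∀ c : U.Zhu 0, φ (c • x) = 0 := by
        refine Submodule.span_induction (p := fun x _ => ∀ c : U.Zhu 0, φ (c • x) = 0)
          ?_ ?_ ?_ ?_ hx
        · rintro x (⟨a, β, hβ, rfl⟩ | ⟨a, b, β, rfl⟩) c
          · rw [TensorProduct.smul_tmul', hφt]
            obtain ⟨u, hu⟩ := U.zhuMk_surjective _ (c • a)
            rw [← hu, muMid_mk]
            refine zhuMk_eq_zero _ ?_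
            rw [comp_left (U.comp d α).2 _ (q := -d) (by ring),
              comp_right (U.comp (-d) β).2 _ (p := 0) (by ring), comp_of_mem u.2]
            have h := hβ (-d)
            have h2 := U.mul_nbhd _ _ _ _ _ u.2 h (U.comp (-d) β).2
            have h3 := U.mul_nbhd _ _ (0 + -d) _ _ (U.comp d α).2 h2
              (SetLike.mul_mem_graded u.2 (U.comp (-d) β).2)
            rwa [show (1 - -d : ℤ) = d + 1 by ring] at h3
          · rw [smul_sub, TensorProduct.smul_tmul', TensorProduct.smul_tmul', map_sub, hφt, hφt,
              sub_eq_zero, smul_eq_mul, smul_eq_mul, ← mul_assoc]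
            obtain ⟨u, hu⟩ := U.zhuMk_surjective _ (c * a)
            rw [← hu, ← map_mul, muMid_mk, muMid_mk]
            have h : ((u * b : U.deg 0) : U.carrier) * U.comp (-d) β =
                u * U.comp (-d) ((b : U.carrier) * β) := by
              rw [comp_left b.2 β (zero_add (-d)), ← mul_assoc]
              rfl
            rw [h]
        · simp
        · intro x y _ _ hx hy c
          rw [smul_add, map_add, hx, hy, add_zero]
        · intro e x _ hx c
          rw [smul_smul, hx]
      simpa using key 1)

theorem muRight_tmul (d : ℤ) (α : U.carrier) (u : U.deg 0) (β : U.carrier) :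
    muRight d α (U.phiRTmul (U.zhuMk 0 u) β) =
      U.zhuMk d (U.comp 0 (U.comp d α * (u * U.comp (-d) β))) := rfl

theorem phiR_hom_ext {P : Type*} [AddCommGroup P] {f g : U.PhiRZhu →+ P}
    (h : ∀ (u : U.deg 0) β, f (U.phiRTmul (U.zhuMk 0 u) β) = g (U.phiRTmul (U.zhuMk 0 u) β)) :
    f = g := by
  ext x
  refine phiR_induction (P := fun x => f x = g x) x (by simp) (fun a β => ?_) fun x y hx hy => ?_
  · obtain ⟨u, rfl⟩ := U.zhuMk_surjective _ a
    exact h u β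
  · rw [map_add, map_add, hx, hy]

/-- The map `𝔄 → A_d`, `α ⊗ [u]_0 ⊗ β ↦ [α_d u β_{-d}]_d`. -/
def muFull (d : ℤ) : U.MTA →+ U.Zhu d :=
  phiLLift (U := U) (W := U.PhiRZhu)
    (addLift
      { toFun := fun α => muRight d α
        map_zero' := phiR_hom_ext fun u β => by simp [muRight_tmul]
        map_add' := fun α α' => phiR_hom_ext fun u β => by simp [muRight_tmul, add_mul] })
    (fun α hα m => by
      have : muRight d α = 0 := phiR_hom_ext fun u β => by
        rw [muRight_tmul]
        refine zhuMk_eq_zero _ ?_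
        have hm : (u : U.carrier) * U.comp (-d) β ∈ U.deg (0 + -d) :=
          SetLike.mul_mem_graded u.2 (U.comp (-d) β).2
        rw [comp_left (U.comp d α).2 _ (q := -d) (by ring),
          comp_right (U.comp (-d) β).2 _ (p := 0) (by ring), comp_of_mem u.2]
        have h := U.nbhd_mul _ _ _ _ _ (U.nbhd_homog _ _ hα d) (U.comp d α).2 hm
        rwa [show (1 - (0 + -d) : ℤ) = d + 1 by ring] at h
      change muRight d α m = 0
      rw [this]; rfl)
    (fun α a m => by
      change muRight d (α * (a : U.carrier)) m = muRight d α (U.zhuMk 0 a • m)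
      refine phiR_induction (P := fun m => muRight d (α * (a : U.carrier)) m = muRight d α (U.zhuMk 0 a • m))
        m (by simp) (fun b β => ?_) fun x y hx hy => ?_
      · obtain ⟨u, rfl⟩ := U.zhuMk_surjective _ b
        have : U.zhuMk 0 a • U.phiRTmul (U.zhuMk 0 u) β = U.phiRTmul (U.zhuMk 0 (a * u)) β := rfl
        rw [this, muRight_tmul, muRight_tmul, comp_right a.2 α (add_zero d)]
        congr 2
        simp [mul_assoc]
      · rw [smul_add, map_add, map_add, hx, hy])

variable (U)

/-- The map `μ_d : 𝔄_d → A_d`, `α ⊗ [u]_0 ⊗ β ↦ [α u β]_d`. -/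
def mu (d : ℕ) : U.MTAd d →+ U.Zhu d := (muFull (d : ℤ)).comp (U.mtaBideg d (-d)).subtype

/-- `μ_d(α ⊗ [u]_0 ⊗ β) = [α u β]_d` for `α ∈ U_d`, `u ∈ U_0`, `β ∈ U_{-d}`. -/
theorem mu_tmul (d : ℕ) (α : U.deg d) (u : U.deg 0) (β : U.deg (-d : ℤ))
    (h : U.mtaTmul α (U.zhuMk 0 u) β ∈ U.MTAd d)
    (h' : (α : U.carrier) * u * β ∈ U.deg 0) :
    U.mu d ⟨_, h⟩ = U.zhuMk d ⟨α * u * β, h'⟩ := by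
  change U.zhuMk d (U.comp 0 (U.comp d (α : U.carrier) * (u * U.comp (-d) (β : U.carrier)))) = _
  congr 1
  apply Subtype.ext
  rw [comp_of_mem α.2, comp_of_mem β.2, ← mul_assoc, comp_of_mem h']

/-- The sequence `𝔄_d → A_d → A_{d-1} → 0` splits at `d` as a product of rings: there is a ring
isomorphism `A_d ≅ 𝔄_d × A_{d-1}` that identifies `μ_d` with the inclusion of the first factor and
`π_d` with the projection to the second one. -/
def SplitsAsProduct (d : ℕ) : Prop :=
  ∃ e : U.Zhu d ≃+* U.MTAd d × U.Zhu (d - 1),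
    (∀ x : U.MTAd d, e (U.mu d x) = (x, 0)) ∧ ∀ a : U.Zhu d, (e a).2 = U.zhuProj d a

end SeminormedGradedRing

/-! ### Graded completion with respect to the canonical neighbourhoods -/

section Completion

variable {R : Type u} [Ring R] (𝒜 : ℤ → AddSubgroup R)

/-- The canonical neighbourhood `N_L^n R_p = (R R_{≤ -n})_p = ∑_{j ≤ -n} R_{p-j} R_j`. -/
def gradedNbhd (n p : ℤ) : AddSubgroup R :=
  AddSubgroup.closure {z | ∃ j ≤ -n, ∃ x ∈ 𝒜 (p - j), ∃ y ∈ 𝒜 j, z = x * y}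

/-- The quotient `R_p / N_L^n R_p`. -/
abbrev GradedQuot (n p : ℤ) : Type u := 𝒜 p ⧸ (gradedNbhd 𝒜 n p).addSubgroupOf (𝒜 p)

/-- The class of an element of `R_p` in `R_p / N_L^n R_p`. -/
abbrev gq (n p : ℤ) : 𝒜 p →+ GradedQuot 𝒜 n p :=
  QuotientAddGroup.mk' ((gradedNbhd 𝒜 n p).addSubgroupOf (𝒜 p))

variable {𝒜}

theorem gq_eq {n p : ℤ} {u v : 𝒜 p} :
    gq 𝒜 n p u = gq 𝒜 n p v ↔ (u : R) - v ∈ gradedNbhd 𝒜 n p := by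
  rw [← sub_eq_zero, ← map_sub, QuotientAddGroup.mk'_apply, QuotientAddGroup.eq_zero_iff,
    AddSubgroup.mem_addSubgroupOf]
  rfl

theorem gradedNbhd_anti {m n : ℤ} (h : m ≤ n) (p : ℤ) : gradedNbhd 𝒜 n p ≤ gradedNbhd 𝒜 m p :=
  AddSubgroup.closure_mono fun _ ⟨j, hj, hz⟩ => ⟨j, by lia, hz⟩

variable (𝒜)

/-- The completion `R̂_p = lim_n R_p / N_L^n R_p`, as the group of compatible families. -/
def complPiece (p : ℤ) : AddSubgroup (∀ n : ℤ, GradedQuot 𝒜 n p) where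
  carrier := {x | ∀ n, ∃ u : 𝒜 p, ∀ m ≤ n, x m = gq 𝒜 m p u}
  zero_mem' n := ⟨0, fun m _ => by simp⟩
  add_mem' {x y} hx hy n := by
    obtain ⟨u, hu⟩ := hx n
    obtain ⟨v, hv⟩ := hy n
    exact ⟨u + v, fun m hm => by rw [Pi.add_apply, hu m hm, hv m hm, map_add]⟩
  neg_mem' {x} hx n := by
    obtain ⟨u, hu⟩ := hx n
    exact ⟨-u, fun m hm => by rw [Pi.neg_apply, hu m hm, map_neg]⟩

/-- The canonical map `R_p → R̂_p`. -/
def toCompl (p : ℤ) (u : 𝒜 p) : complPiece 𝒜 p :=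
  ⟨fun n => gq 𝒜 n p u, fun _ => ⟨u, fun _ _ => rfl⟩⟩

/-- The neighbourhood `N_L^n R̂_p`, the kernel of `R̂_p → R_p / N_L^n R_p`. -/
def complNbhd (n p : ℤ) : AddSubgroup (complPiece 𝒜 p) where
  carrier := {x | x.1 n = 0}
  zero_mem' := rfl
  add_mem' {x y} hx hy := by
    change x.1 n + y.1 n = 0
    rw [show x.1 n = 0 from hx, show y.1 n = 0 from hy, add_zero]
  neg_mem' {x} hx := by
    change - x.1 n = 0
    rw [show x.1 n = 0 from hx, neg_zero]

variable {𝒜}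

/-- `u` represents `x` up to level `n`. -/
def IsRep {p : ℤ} (x : complPiece 𝒜 p) (n : ℤ) (u : 𝒜 p) : Prop := ∀ m ≤ n, x.1 m = gq 𝒜 m p u

theorem exists_isRep {p : ℤ} (x : complPiece 𝒜 p) (n : ℤ) : ∃ u, IsRep x n u := x.2 n

theorem isRep_of_eq {p n : ℤ} {x : complPiece 𝒜 p} {u : 𝒜 p} (h : x.1 n = gq 𝒜 n p u) :
    IsRep x n u := by
  obtain ⟨v, hv⟩ := exists_isRep x n
  intro m hm
  rw [hv m hm, gq_eq]
  rw [hv n le_rfl, gq_eq] at h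
  exact gradedNbhd_anti hm p h

theorem IsRep.mono {p m n : ℤ} {x : complPiece 𝒜 p} {u : 𝒜 p} (h : IsRep x n u) (hm : m ≤ n) :
    IsRep x m u := fun k hk => h k (hk.trans hm)

theorem IsRep.add {p n : ℤ} {x y : complPiece 𝒜 p} {u v : 𝒜 p} (h : IsRep x n u)
    (h' : IsRep y n v) : IsRep (x + y) n (u + v) := fun m hm => by
  rw [map_add, ← h m hm, ← h' m hm]; rfl

theorem isRep_zero {p n : ℤ} : IsRep (0 : complPiece 𝒜 p) n 0 := fun m _ => by
  rw [map_zero]; rfl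

theorem isRep_toCompl {p n : ℤ} (u : 𝒜 p) : IsRep (toCompl 𝒜 p u) n u := fun _ _ => rfl

theorem compl_ext {p : ℤ} {x y : complPiece 𝒜 p} (h : ∀ n, ∃ u, IsRep x n u ∧ IsRep y n u) :
    x = y := by
  apply Subtype.ext
  funext n
  obtain ⟨u, hx, hy⟩ := h n
  rw [hx n le_rfl, hy n le_rfl]

theorem mem_complNbhd {n p : ℤ} {x : complPiece 𝒜 p} {u : 𝒜 p} (h : IsRep x n u) :
    x ∈ complNbhd 𝒜 n p ↔ (u : R) ∈ gradedNbhd 𝒜 n p := by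
  change x.1 n = 0 ↔ _
  rw [h n le_rfl, ← map_zero (gq 𝒜 n p), gq_eq]
  simp

theorem compl_sigma_ext {p q : ℤ} (hpq : p = q) {x : complPiece 𝒜 p} {y : complPiece 𝒜 q}
    (h : ∀ n, ∃ (u : 𝒜 p) (v : 𝒜 q), (u : R) = v ∧ IsRep x n u ∧ IsRep y n v) :
    (GradedMonoid.mk p x : GradedMonoid fun p => complPiece 𝒜 p) = GradedMonoid.mk q y := by
  subst hpq
  congr 1
  refine compl_ext fun n => ?_
  obtain ⟨u, v, huv, hx, hy⟩ := h n
  obtain rfl := Subtype.ext huv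
  exact ⟨u, hx, hy⟩

variable [SetLike.GradedMonoid 𝒜]

theorem gradedNbhd_mul {n p q : ℤ} {x y : R} (hx : x ∈ gradedNbhd 𝒜 n p) (hy : y ∈ 𝒜 q) :
    x * y ∈ gradedNbhd 𝒜 (n - q) (p + q) := by
  induction hx using AddSubgroup.closure_induction with
  | mem x hx =>
    obtain ⟨j, hj, a, ha, b, hb, rfl⟩ := hx
    refine AddSubgroup.subset_closure ⟨j + q, by lia, a, ?_, b * y, SetLike.mul_mem_graded hb hy,
      mul_assoc _ _ _⟩
    rwa [show p + q - (j + q) = p - j by ring]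
  | zero => rw [zero_mul]; exact zero_mem _
  | add _ _ _ _ h h' => rw [add_mul]; exact add_mem h h'
  | neg _ _ h => rw [neg_mul]; exact neg_mem h

theorem mul_gradedNbhd {n p q : ℤ} {x y : R} (hx : x ∈ 𝒜 p) (hy : y ∈ gradedNbhd 𝒜 n q) :
    x * y ∈ gradedNbhd 𝒜 n (p + q) := by
  induction hy using AddSubgroup.closure_induction with
  | mem y hy =>
    obtain ⟨j, hj, a, ha, b, hb, rfl⟩ := hy
    refine AddSubgroup.subset_closure ⟨j, hj, x * a, ?_, b, hb, (mul_assoc _ _ _).symm⟩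
    rw [show p + q - j = p + (q - j) by ring]
    exact SetLike.mul_mem_graded hx ha
  | zero => rw [mul_zero]; exact zero_mem _
  | add _ _ _ _ h h' => rw [mul_add]; exact add_mem h h'
  | neg _ _ h => rw [mul_neg]; exact neg_mem h

/-- The product of elements of `R_p` and `R_q`. -/
def gmul {p q : ℤ} (u : 𝒜 p) (v : 𝒜 q) : 𝒜 (p + q) := ⟨u * v, SetLike.mul_mem_graded u.2 v.2⟩

theorem gq_gmul {n p q : ℤ} {u u' : 𝒜 p} {v v' : 𝒜 q}
    (hu : gq 𝒜 (n + q) p u = gq 𝒜 (n + q) p u') (hv : gq 𝒜 n q v = gq 𝒜 n q v') :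
    gq 𝒜 n (p + q) (gmul u v) = gq 𝒜 n (p + q) (gmul u' v') := by
  rw [gq_eq] at hu hv ⊢
  have h1 := gradedNbhd_mul hu v.2
  have h2 := mul_gradedNbhd u'.2 hv
  rw [add_sub_cancel_right] at h1
  have := add_mem h1 h2
  convert this using 1
  change (u : R) * v - u' * v' = _
  noncomm_ring

/-- The product `R̂_p × R̂_q → R̂_{p+q}`, the extension by continuity of the product of `R`. -/
def complMul {p q : ℤ} (x : complPiece 𝒜 p) (y : complPiece 𝒜 q) : complPiece 𝒜 (p + q) :=
  ⟨fun n => gq 𝒜 n (p + q)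
      (gmul (exists_isRep x (n + q)).choose (exists_isRep y n).choose), fun n => by
    refine ⟨gmul (exists_isRep x (n + q)).choose (exists_isRep y n).choose, fun m hm => ?_⟩
    refine gq_gmul ?_ ?_
    · rw [← (exists_isRep x (m + q)).choose_spec _ le_rfl,
        (exists_isRep x (n + q)).choose_spec _ (by lia)]
    · rw [← (exists_isRep y m).choose_spec _ le_rfl, (exists_isRep y n).choose_spec _ hm]⟩

theorem IsRep.mul {n p q : ℤ} {x : complPiece 𝒜 p} {y : complPiece 𝒜 q} {u : 𝒜 p} {v : 𝒜 q}
    (hu : IsRep x (n + q) u) (hv : IsRep y n v) : IsRep (complMul x y) n (gmul u v) := by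
  intro m hm
  refine gq_gmul ?_ ?_
  · rw [← (exists_isRep x (m + q)).choose_spec _ le_rfl, hu _ (by lia)]
  · rw [← (exists_isRep y m).choose_spec _ le_rfl, hv _ hm]

/-- The unit of `R_0`. -/
def gone : 𝒜 0 := ⟨1, SetLike.one_mem_graded 𝒜⟩

theorem complMul_zero {p q : ℤ} (x : complPiece 𝒜 p) : complMul x (0 : complPiece 𝒜 q) = 0 :=
  compl_ext fun n => by
    obtain ⟨u, hu⟩ := exists_isRep x (n + q)
    refine ⟨0, ?_, isRep_zero⟩
    have h := hu.mul (isRep_zero (𝒜 := 𝒜) (p := q))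
    rwa [show gmul u (0 : 𝒜 q) = 0 from Subtype.ext (mul_zero _)] at h

theorem zero_complMul {p q : ℤ} (y : complPiece 𝒜 q) : complMul (0 : complPiece 𝒜 p) y = 0 :=
  compl_ext fun n => by
    obtain ⟨v, hv⟩ := exists_isRep y n
    refine ⟨0, ?_, isRep_zero⟩
    have h := (isRep_zero (𝒜 := 𝒜) (p := p)).mul hv
    rwa [show gmul (0 : 𝒜 p) v = 0 from Subtype.ext (zero_mul _)] at h

theorem complMul_add {p q : ℤ} (x : complPiece 𝒜 p) (y z : complPiece 𝒜 q) :
    complMul x (y + z) = complMul x y + complMul x z :=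
  compl_ext fun n => by
    obtain ⟨u, hu⟩ := exists_isRep x (n + q)
    obtain ⟨v, hv⟩ := exists_isRep y n
    obtain ⟨w, hw⟩ := exists_isRep z n
    refine ⟨_, hu.mul (hv.add hw), ?_⟩
    rw [show gmul u (v + w) = gmul u v + gmul u w from Subtype.ext (mul_add _ _ _)]
    exact (hu.mul hv).add (hu.mul hw)

theorem add_complMul {p q : ℤ} (x y : complPiece 𝒜 p) (z : complPiece 𝒜 q) :
    complMul (x + y) z = complMul x z + complMul y z :=
  compl_ext fun n => by
    obtain ⟨u, hu⟩ := exists_isRep x (n + q)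
    obtain ⟨v, hv⟩ := exists_isRep y (n + q)
    obtain ⟨w, hw⟩ := exists_isRep z n
    refine ⟨_, (hu.add hv).mul hw, ?_⟩
    rw [show gmul (u + v) w = gmul u w + gmul v w from Subtype.ext (add_mul _ _ _)]
    exact (hu.mul hw).add (hv.mul hw)

instance : GradedMonoid.GMul fun p => complPiece 𝒜 p := ⟨complMul⟩

instance : GradedMonoid.GOne fun p => complPiece 𝒜 p := ⟨toCompl 𝒜 0 gone⟩

instance : DirectSum.GRing fun p => complPiece 𝒜 p where
  mul_zero := complMul_zero
  zero_mul := zero_complMul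
  mul_add := complMul_add
  add_mul := add_complMul
  one_mul a := compl_sigma_ext (zero_add _) fun n => by
    obtain ⟨u, hu⟩ := exists_isRep a.2 n
    exact ⟨_, u, one_mul _, (isRep_toCompl gone).mul hu, hu⟩
  mul_one a := compl_sigma_ext (add_zero _) fun n => by
    obtain ⟨u, hu⟩ := exists_isRep a.2 (n + 0)
    exact ⟨_, u, mul_one _, hu.mul (isRep_toCompl gone), hu.mono (by simp)⟩
  mul_assoc a b c := compl_sigma_ext (add_assoc _ _ _) fun n => by
    obtain ⟨u, hu⟩ := exists_isRep a.2 (n + (b.1 + c.1))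
    obtain ⟨v, hv⟩ := exists_isRep b.2 (n + c.1)
    obtain ⟨w, hw⟩ := exists_isRep c.2 n
    refine ⟨_, _, mul_assoc _ _ _, IsRep.mul (IsRep.mul (hu.mono ?_) hv) hw,
      hu.mul (hv.mul hw)⟩
    lia
  natCast n := n • toCompl 𝒜 0 gone
  natCast_zero := zero_smul _ _
  natCast_succ n := succ_nsmul _ _
  intCast n := n • toCompl 𝒜 0 gone
  intCast_ofNat n := natCast_zsmul _ _
  intCast_negSucc_ofNat n := negSucc_zsmul _ _

variable (𝒜)

/-- The graded completion `R̂ = ⨁_p R̂_p`. -/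
abbrev Compl : Type u := ⨁ p : ℤ, complPiece 𝒜 p

variable {𝒜}

/-- The inclusion `R̂_p ⊆ R̂`. -/
abbrev cof (p : ℤ) : complPiece 𝒜 p →+ Compl 𝒜 := DirectSum.of (fun p => complPiece 𝒜 p) p

theorem cof_mul_cof {p q : ℤ} (x : complPiece 𝒜 p) (y : complPiece 𝒜 q) :
    cof p x * cof q y = cof (p + q) (complMul x y) := by
  have h := DirectSum.of_mul_of (A := fun p => complPiece 𝒜 p) x y
  exact h

theorem complMul_nbhd_left {n p q : ℤ} {x : complPiece 𝒜 p} (hx : x ∈ complNbhd 𝒜 n p)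
    (y : complPiece 𝒜 q) : complMul x y ∈ complNbhd 𝒜 (n - q) (p + q) := by
  obtain ⟨u, hu⟩ := exists_isRep x n
  obtain ⟨v, hv⟩ := exists_isRep y (n - q)
  rw [mem_complNbhd (IsRep.mul (hu.mono (by lia)) hv)]
  exact gradedNbhd_mul ((mem_complNbhd hu).1 hx) v.2

theorem complMul_nbhd_right {n p q : ℤ} (x : complPiece 𝒜 p) {y : complPiece 𝒜 q}
    (hy : y ∈ complNbhd 𝒜 n q) : complMul x y ∈ complNbhd 𝒜 n (p + q) := by
  obtain ⟨u, hu⟩ := exists_isRep x (n + q)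
  obtain ⟨v, hv⟩ := exists_isRep y n
  rw [mem_complNbhd (hu.mul hv)]
  exact mul_gradedNbhd u.2 ((mem_complNbhd hv).1 hy)

theorem complMul_sub_left {p q : ℤ} (x x' : complPiece 𝒜 p) (y : complPiece 𝒜 q) :
    complMul (x - x') y = complMul x y - complMul x' y := by
  rw [eq_sub_iff_add_eq, ← add_complMul, sub_add_cancel]

theorem complMul_sub_right {p q : ℤ} (x : complPiece 𝒜 p) (y y' : complPiece 𝒜 q) :
    complMul x (y - y') = complMul x y - complMul x y' := by
  rw [eq_sub_iff_add_eq, ← complMul_add, sub_add_cancel]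

/-! ### Closed ideals and the quotient -/

/-- The closure of `J ∩ R̂_p` in `R̂_p`. -/
def closurePiece (J : TwoSidedIdeal (Compl 𝒜)) (p : ℤ) : AddSubgroup (complPiece 𝒜 p) where
  carrier := {x | ∀ n, ∃ y : complPiece 𝒜 p, cof p y ∈ J ∧ x - y ∈ complNbhd 𝒜 n p}
  zero_mem' n := ⟨0, by rw [map_zero]; exact J.zero_mem, by rw [sub_zero]; exact zero_mem _⟩
  add_mem' {x x'} hx hx' n := by
    obtain ⟨y, hy, h⟩ := hx n
    obtain ⟨y', hy', h'⟩ := hx' n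
    refine ⟨y + y', by rw [map_add]; exact J.add_mem hy hy', ?_⟩
    rw [add_sub_add_comm]
    exact add_mem h h'
  neg_mem' {x} hx n := by
    obtain ⟨y, hy, h⟩ := hx n
    refine ⟨-y, by rw [map_neg]; exact J.neg_mem hy, ?_⟩
    rw [← neg_sub']
    exact neg_mem h

theorem closurePiece_mul_left (J : TwoSidedIdeal (Compl 𝒜)) {p q : ℤ} (x : complPiece 𝒜 p)
    {y : complPiece 𝒜 q} (hy : y ∈ closurePiece J q) : complMul x y ∈ closurePiece J (p + q) := by
  intro n
  obtain ⟨z, hz, h⟩ := hy n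
  refine ⟨complMul x z, ?_, ?_⟩
  · rw [← cof_mul_cof]; exact J.mul_mem_left _ _ hz
  · rw [← complMul_sub_right]; exact complMul_nbhd_right x h

theorem closurePiece_mul_right (J : TwoSidedIdeal (Compl 𝒜)) {p q : ℤ} {x : complPiece 𝒜 p}
    (y : complPiece 𝒜 q) (hx : x ∈ closurePiece J p) :
    complMul x y ∈ closurePiece J (p + q) := by
  intro n
  obtain ⟨z, hz, h⟩ := hx (n + q)
  refine ⟨complMul z y, ?_, ?_⟩
  · rw [← cof_mul_cof]; exact J.mul_mem_right _ _ hz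
  · rw [← complMul_sub_left]
    have := complMul_nbhd_left h y
    rwa [add_sub_cancel_right] at this

/-- The elements of `R̂` all of whose components lie in the closures of the pieces of `J`. -/
def closureAdd (J : TwoSidedIdeal (Compl 𝒜)) : AddSubgroup (Compl 𝒜) where
  carrier := {x | ∀ p, x p ∈ closurePiece J p}
  zero_mem' _ := zero_mem _
  add_mem' hx hy p := add_mem (hx p) (hy p)
  neg_mem' hx p := neg_mem (hx p)

theorem cof_mem_closureAdd {J : TwoSidedIdeal (Compl 𝒜)} {p : ℤ} {x : complPiece 𝒜 p}
    (hx : x ∈ closurePiece J p) : cof p x ∈ closureAdd J := by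
  intro q
  by_cases h : p = q
  · subst h
    rw [DirectSum.of_eq_same]
    exact hx
  · rw [DirectSum.of_eq_of_ne _ _ _ (Ne.symm h)]
    exact zero_mem _

theorem closureAdd_induction {J : TwoSidedIdeal (Compl 𝒜)} {P : Compl 𝒜 → Prop} {x : Compl 𝒜}
    (hx : x ∈ closureAdd J) (h0 : P 0)
    (h1 : ∀ p, ∀ y ∈ closurePiece J p, P (cof p y)) (h2 : ∀ x y, P x → P y → P (x + y)) : P x := by
  classical
  rw [← DirectSum.sum_support_of x]
  exact Finset.sum_induction _ P h2 h0 fun p _ => h1 p _ (hx p)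

/-- The closure of a two-sided ideal `J` of `R̂`, taken degree by degree. -/
def idealClosure (J : TwoSidedIdeal (Compl 𝒜)) : Ideal (Compl 𝒜) :=
  { closureAdd J with
    smul_mem' := by
      intro c x hx
      change c * x ∈ closureAdd J
      refine closureAdd_induction (P := fun x => c * x ∈ closureAdd J) hx ?_ ?_ ?_
      · rw [mul_zero]; exact zero_mem _
      · intro q y hy
        induction c using DirectSum.induction_on with
        | zero => rw [zero_mul]; exact zero_mem _
        | of p c =>
          rw [cof_mul_cof]
          exact cof_mem_closureAdd (closurePiece_mul_left J c hy)
        | add a b ha hb => rw [add_mul]; exact add_mem ha hb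
      · intro a b ha hb
        rw [mul_add]; exact add_mem ha hb }

theorem mem_idealClosure {J : TwoSidedIdeal (Compl 𝒜)} {x : Compl 𝒜} :
    x ∈ idealClosure J ↔ ∀ p, x p ∈ closurePiece J p := Iff.rfl

instance (J : TwoSidedIdeal (Compl 𝒜)) : (idealClosure J).IsTwoSided where
  mul_mem_of_left {x} c hx := by
    change x * c ∈ closureAdd J
    refine closureAdd_induction (P := fun x => x * c ∈ closureAdd J) hx ?_ ?_ ?_
    · rw [zero_mul]; exact zero_mem _
    · intro q y hy
      induction c using DirectSum.induction_on with
      | zero => rw [mul_zero]; exact zero_mem _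
      | of p c =>
        rw [cof_mul_cof]
        exact cof_mem_closureAdd (closurePiece_mul_right J c hy)
      | add a b ha hb => rw [mul_add]; exact add_mem ha hb
    · intro a b ha hb
      rw [add_mul]; exact add_mem ha hb

variable (J : TwoSidedIdeal (Compl 𝒜))

/-- The quotient of `R̂` by the closure of `J`. -/
abbrev ComplQuot : Type u := Compl 𝒜 ⧸ idealClosure J

/-- The map `R̂_p → R̂ / J̄`. -/
def quotOf (p : ℤ) : complPiece 𝒜 p →+ ComplQuot J :=
  (Ideal.Quotient.mk (idealClosure J)).toAddMonoidHom.comp (cof p)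

/-- The degree `p` part of `R̂ / J̄`, the image of `R̂_p`. -/
def quotDeg (p : ℤ) : AddSubgroup (ComplQuot J) := (quotOf J p).range

/-- The neighbourhoods of the quotient: the images of `N_L^n R̂ = ⨁_p N_L^n R̂_p`. -/
def quotNbhd (n : ℤ) : AddSubgroup (ComplQuot J) :=
  ⨆ p : ℤ, (complNbhd 𝒜 n p).map (quotOf J p)

instance : SetLike.GradedMonoid (quotDeg J) where
  one_mem := ⟨_, rfl⟩
  mul_mem := by
    rintro p q _ _ ⟨x, rfl⟩ ⟨y, rfl⟩
    refine ⟨complMul x y, ?_⟩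
    change Ideal.Quotient.mk _ (cof (p + q) (complMul x y)) = _
    rw [← cof_mul_cof, map_mul]
    rfl

/-- The map `R̂_p → (R̂ / J̄)_p`. -/
def quotToDeg (p : ℤ) : complPiece 𝒜 p →+ quotDeg J p where
  toFun x := ⟨quotOf J p x, x, rfl⟩
  map_zero' := Subtype.ext (map_zero (quotOf J p))
  map_add' x y := Subtype.ext (map_add (quotOf J p) x y)

/-- The decomposition of `R̂ / J̄` into its homogeneous components, on representatives. -/
def quotDecomposeAux : Compl 𝒜 →+ ⨁ p : ℤ, quotDeg J p :=
  DirectSum.toAddMonoid fun p => (DirectSum.of (fun p => quotDeg J p) p).comp (quotToDeg J p)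

theorem quotDecomposeAux_cof (p : ℤ) (x : complPiece 𝒜 p) :
    quotDecomposeAux J (cof p x) = DirectSum.of (fun p => quotDeg J p) p (quotToDeg J p x) := by
  have h := DirectSum.toAddMonoid_of
    (fun p => (DirectSum.of (fun p => quotDeg J p) p).comp (quotToDeg J p)) p x
  exact h

theorem quotOf_eq_zero {p : ℤ} {x : complPiece 𝒜 p} (hx : x ∈ closurePiece J p) :
    quotOf J p x = 0 :=
  Ideal.Quotient.eq_zero_iff_mem.2 (cof_mem_closureAdd hx)

/-- The decomposition of `R̂ / J̄` into its homogeneous components. -/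
def quotDecompose : ComplQuot J →+ ⨁ p : ℤ, quotDeg J p :=
  QuotientAddGroup.lift (idealClosure J).toAddSubgroup (quotDecomposeAux J) (by
    intro x hx
    refine closureAdd_induction (P := fun x => quotDecomposeAux J x = 0) hx (map_zero _) ?_ ?_
    · intro p y hy
      have : quotToDeg J p y = 0 := Subtype.ext (quotOf_eq_zero J hy)
      rw [quotDecomposeAux_cof, this, map_zero]
    · intro a b ha hb
      rw [map_add, ha, hb, add_zero])

theorem quotDecompose_quotOf (p : ℤ) (x : complPiece 𝒜 p) :
    quotDecompose J (quotOf J p x) =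
      DirectSum.of (fun p => quotDeg J p) p (quotToDeg J p x) :=
  quotDecomposeAux_cof J p x

theorem complQuot_induction {P : ComplQuot J → Prop} (x : ComplQuot J) (h0 : P 0)
    (h1 : ∀ p x, P (quotOf J p x)) (h2 : ∀ x y, P x → P y → P (x + y)) : P x := by
  obtain ⟨x, rfl⟩ := Ideal.Quotient.mk_surjective x
  induction x using DirectSum.induction_on with
  | zero => rw [map_zero]; exact h0
  | of p x => exact h1 p x
  | add a b ha hb => rw [map_add]; exact h2 _ _ ha hb

instance : DirectSum.Decomposition (quotDeg J) :=
  DirectSum.Decomposition.ofAddHom (quotDeg J) (quotDecompose J)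
    (by
      ext x
      refine complQuot_induction J (P := fun x => ((DirectSum.coeAddMonoidHom (quotDeg J)).comp
        (quotDecompose J)) x = AddMonoidHom.id _ x) x ?_ ?_ ?_
      · simp
      · intro p x
        rw [AddMonoidHom.comp_apply, quotDecompose_quotOf, DirectSum.coeAddMonoidHom_of]
        rfl
      · intro a b ha hb
        rw [map_add, ha, hb, map_add])
    (by
      refine DirectSum.addHom_ext' fun p => ?_
      ext ⟨_, x, rfl⟩ : 1
      rw [AddMonoidHom.comp_apply, AddMonoidHom.comp_apply, DirectSum.coeAddMonoidHom_of,
        quotDecompose_quotOf]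
      rfl)

instance : GradedRing (quotDeg J) where

theorem mem_quotNbhd_of {n p : ℤ} {x : complPiece 𝒜 p} (hx : x ∈ complNbhd 𝒜 n p) :
    quotOf J p x ∈ quotNbhd J n :=
  (le_iSup (fun p => (complNbhd 𝒜 n p).map (quotOf J p)) p) ⟨x, hx, rfl⟩

theorem decompose_quotOf_same (p : ℤ) (x : complPiece 𝒜 p) :
    (DirectSum.decompose (quotDeg J) (quotOf J p x) p : ComplQuot J) = quotOf J p x :=
  DirectSum.decompose_of_mem_same (quotDeg J) ⟨x, rfl⟩

theorem decompose_quotOf_ne {p q : ℤ} (h : p ≠ q) (x : complPiece 𝒜 p) :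
    (DirectSum.decompose (quotDeg J) (quotOf J p x) q : ComplQuot J) = 0 :=
  DirectSum.decompose_of_mem_ne (quotDeg J) ⟨x, rfl⟩ h

theorem quotNbhd_homog (n : ℤ) (x : ComplQuot J) (hx : x ∈ quotNbhd J n) (p : ℤ) :
    ∃ y ∈ complNbhd 𝒜 n p,
      (DirectSum.decompose (quotDeg J) x p : ComplQuot J) = quotOf J p y := by
  induction hx using AddSubgroup.iSup_induction' with
  | hp q x hx =>
    obtain ⟨y, hy, rfl⟩ := hx
    by_cases h : q = p
    · subst h
      exact ⟨y, hy, decompose_quotOf_same J _ y⟩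
    · exact ⟨0, zero_mem _, by rw [decompose_quotOf_ne J h, map_zero]⟩
  | h1 => exact ⟨0, zero_mem _, by simp⟩
  | hadd x y _ _ h h' =>
    obtain ⟨a, ha, e⟩ := h
    obtain ⟨b, hb, e'⟩ := h'
    refine ⟨a + b, add_mem ha hb, ?_⟩
    rw [DirectSum.decompose_add, map_add, ← e, ← e']
    rfl

theorem quotOf_mul {p q : ℤ} (x : complPiece 𝒜 p) (y : complPiece 𝒜 q) :
    quotOf J p x * quotOf J q y = quotOf J (p + q) (complMul x y) := by
  change Ideal.Quotient.mk _ (cof p x) * Ideal.Quotient.mk _ (cof q y) =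
    Ideal.Quotient.mk _ (cof (p + q) (complMul x y))
  rw [← map_mul, cof_mul_cof]

theorem gradedNbhd_of_nonpos {n p : ℤ} (hn : n ≤ 0) : 𝒜 p ≤ gradedNbhd 𝒜 n p := fun x hx =>
  AddSubgroup.subset_closure ⟨0, by lia, x, by rwa [sub_zero], 1, SetLike.one_mem_graded 𝒜,
    (mul_one x).symm⟩

/-- The quotient of the graded completion of `R` by the closure of `J`, as a graded ring with its
quotient seminorm. -/
def complQuotRing : SeminormedGradedRing.{u} where
  carrier := ComplQuot J
  deg := quotDeg J
  nbhd := quotNbhd J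
  nbhd_anti n := iSup_mono fun p => AddSubgroup.map_mono fun x hx => by
    obtain ⟨u, hu⟩ := exists_isRep x (n + 1)
    rw [mem_complNbhd (hu.mono (by lia))]
    exact gradedNbhd_anti (by lia) p ((mem_complNbhd hu).1 hx)
  nbhd_exhaust x := ⟨0, by
    refine complQuot_induction J (P := fun x => x ∈ quotNbhd J 0) x (zero_mem _) ?_
      fun _ _ => add_mem
    intro p x
    refine mem_quotNbhd_of J ?_
    obtain ⟨u, hu⟩ := exists_isRep x 0
    rw [mem_complNbhd hu]
    exact gradedNbhd_of_nonpos le_rfl u.2⟩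
  nbhd_homog n x hx p := by
    obtain ⟨y, hy, e⟩ := quotNbhd_homog J n x hx p
    rw [e]
    exact mem_quotNbhd_of J hy
  nbhd_mul n p q x y hx hxp hy := by
    obtain ⟨x', hx', e⟩ := quotNbhd_homog J n x hx p
    obtain ⟨y', rfl⟩ := hy
    rw [DirectSum.decompose_of_mem_same (quotDeg J) hxp] at e
    rw [e, quotOf_mul]
    exact mem_quotNbhd_of J (complMul_nbhd_left hx' y')
  mul_nbhd n p q x y hx hy hyq := by
    obtain ⟨y', hy', e⟩ := quotNbhd_homog J n y hy q
    obtain ⟨x', rfl⟩ := hx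
    rw [DirectSum.decompose_of_mem_same (quotDeg J) hyq] at e
    rw [e, quotOf_mul]
    exact mem_quotNbhd_of J (complMul_nbhd_right x' hy')

end Completion

/-! ### Vertex operator algebras -/

section VOA

/-- A vertex operator algebra of CFT type with underlying vector space `V`: `gr n` is `V_n`, `vac` is
the vacuum vector, `omega` the conformal vector, `mode a m` is the endomorphism `a_(m)`, and `charge`
is the central charge. -/
structure VertexOperatorAlgebra (V : Type v) [AddCommGroup V] [Module ℂ V] where
  gr : ℕ → Submodule ℂ V
  vac : V
  omega : V
  mode : V →ₗ[ℂ] (ℤ → Module.End ℂ V)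
  charge : ℂ
  isInternal_gr : DirectSum.IsInternal gr
  finite_gr : ∀ n, Module.Finite ℂ (gr n)
  finrank_gr_zero : Module.finrank ℂ (gr 0) = 1
  vac_mem : vac ∈ gr 0
  omega_mem : omega ∈ gr 2
  /-- Vertex operators are fields. -/
  mode_eventually_zero : ∀ a b : V, ∃ M : ℤ, ∀ m ≥ M, mode a m b = 0
  mode_vac_neg_one : mode vac (-1) = LinearMap.id
  mode_vac_of_ne : ∀ m : ℤ, m ≠ -1 → mode vac m = 0
  mode_neg_one_vac : ∀ a : V, mode a (-1) vac = a
  mode_nonneg_vac : ∀ (a : V) (m : ℤ), 0 ≤ m → mode a m vac = 0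
  /-- Weak commutativity: the coefficient of `z₁^(-m-1) z₂^(-n-1)` in
  `(z₁ - z₂)^N [Y(a,z₁), Y(b,z₂)]` vanishes. -/
  weak_comm : ∀ a b : V, ∃ N : ℕ, ∀ m n : ℤ,
    ∑ i ∈ Finset.range (N + 1), ((-1) ^ i * (N.choose i : ℂ)) •
      (mode a (m + N - i) * mode b (n + i) - mode b (n + i) * mode a (m + N - i)) = 0
  /-- The Virasoro relations. -/
  virasoro : ∀ p q : ℤ,
    mode omega (p + 1) * mode omega (q + 1) - mode omega (q + 1) * mode omega (p + 1) =
      ((p : ℂ) - q) • mode omega (p + q + 1) +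
        (if p + q = 0 then charge / 12 * ((p : ℂ) ^ 3 - p) else 0) •
          (LinearMap.id : Module.End ℂ V)
  omega_one : ∀ (n : ℕ) (a : V), a ∈ gr n → mode omega 1 a = (n : ℂ) • a
  /-- `Y(ω_(0) a, z) = d/dz Y(a, z)`. -/
  mode_omega_zero : ∀ (a : V) (m : ℤ), mode (mode omega 0 a) m = (-m : ℂ) • mode a (m - 1)

namespace VertexOperatorAlgebra

variable {V : Type v} [AddCommGroup V] [Module ℂ V] (A : VertexOperatorAlgebra V)

/-! ### The enveloping algebra `U` of the finite ancillary algebra -/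

/-- The image of `∇ = L_{-1} ⊗ id + id ⊗ d/dt` on `V ⊗ ℂ[t, t⁻¹]`. -/
def imNabla : Submodule ℂ (V ⊗[ℂ] LaurentPolynomial ℂ) :=
  Submodule.span ℂ {x | ∃ (a : V) (i : ℤ),
    x = A.mode A.omega 0 a ⊗ₜ LaurentPolynomial.T i
      + (i : ℂ) • a ⊗ₜ LaurentPolynomial.T (i - 1)}

/-- The vector space `𝔏(V)^f = V ⊗ ℂ[t, t⁻¹] / Im ∇` underlying the finite ancillary Lie algebra. -/
abbrev FinLie : Type v := (V ⊗[ℂ] LaurentPolynomial ℂ) ⧸ A.imNabla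

/-- The class `a_[i]` of `a ⊗ t^i`. -/
def lieMode (a : V) (i : ℤ) : A.FinLie :=
  A.imNabla.mkQ (a ⊗ₜ LaurentPolynomial.T i)

/-- The relations `x y = y x + [x, y]` for `x = a_[i]`, `y = b_[j]` and the Lie bracket
`[a_[i], b_[j]] = ∑_{k ≥ 0} (i choose k) (a_(k) b)_[i+j-k]` of `𝔏(V)^f`. -/
inductive EnvRel : TensorAlgebra ℂ A.FinLie → TensorAlgebra ℂ A.FinLie → Prop
  | comm (a b : V) (i j : ℤ) (M : ℕ) (hM : ∀ k : ℤ, M ≤ k → A.mode a k b = 0) :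
      EnvRel
        (TensorAlgebra.ι ℂ (A.lieMode a i) * TensorAlgebra.ι ℂ (A.lieMode b j))
        (TensorAlgebra.ι ℂ (A.lieMode b j) * TensorAlgebra.ι ℂ (A.lieMode a i) +
          TensorAlgebra.ι ℂ (∑ k ∈ Finset.range M,
            (Ring.choose i k : ℂ) • A.lieMode (A.mode a k b) (i + j - k)))

/-- The universal enveloping algebra `U` of the Lie algebra `𝔏(V)^f`, i.e. the quotient of the tensor
algebra by the relations `x y - y x = [x, y]`. -/
abbrev Env : Type v := RingQuot A.EnvRel

/-- The element `a_[i]` of `U`. -/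
def envMode (a : V) (i : ℤ) : A.Env :=
  RingQuot.mkAlgHom ℂ A.EnvRel (TensorAlgebra.ι ℂ (A.lieMode a i))

/-- `A.IsMonomial d x` says that `x` is a product of elements `a_[i]`, with `a` homogeneous, of total
degree `d`, where `a_[i]` has degree `deg a - i - 1`. -/
inductive IsMonomial : ℤ → A.Env → Prop
  | one : IsMonomial 0 1
  | mul (q : ℕ) (a : V) (ha : a ∈ A.gr q) (i d : ℤ) (x : A.Env) (hx : IsMonomial d x) :
      IsMonomial ((q - i - 1) + d) (A.envMode a i * x)

/-- The degree `d` part `U_d` of `U`. -/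
def envSpan (d : ℤ) : Submodule ℂ A.Env := Submodule.span ℂ {x | A.IsMonomial d x}

/-- The degree `d` part `U_d` of `U`, as an additive subgroup. -/
def envDeg (d : ℤ) : AddSubgroup A.Env := (A.envSpan d).toAddSubgroup

variable {A} in
theorem IsMonomial.mul_mem {d e : ℤ} {x y : A.Env} (hx : A.IsMonomial d x)
    (hy : A.IsMonomial e y) : A.IsMonomial (d + e) (x * y) := by
  induction hx with
  | one => rwa [zero_add, one_mul]
  | mul q a ha i d x _ ih =>
    rw [add_assoc, mul_assoc]
    exact IsMonomial.mul q a ha i _ _ ih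

instance : SetLike.GradedMonoid A.envDeg where
  one_mem := Submodule.subset_span IsMonomial.one
  mul_mem := by
    intro d e x y hx hy
    change x * y ∈ A.envSpan (d + e)
    have h : A.envSpan d * A.envSpan e ≤ A.envSpan (d + e) := by
      rw [envSpan, envSpan, Submodule.span_mul_span, Submodule.span_le]
      rintro _ ⟨x, hx, y, hy, rfl⟩
      exact Submodule.subset_span (IsMonomial.mul_mem hx hy)
    exact h (Submodule.mul_mem_mul hx hy)

/-! ### The universal enveloping algebra of `V` -/

/-- The partial sums
`∑_{i < M} (-1)^i (ℓ choose i) (a_[m+ℓ-i] b_[n+i] - (-1)^ℓ b_[n+ℓ-i] a_[m+i])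
  - ∑_{i < M} (m choose i) (a_(ℓ+i) b)_[m+n-i]`
of the difference of the two sides of the Jacobi identity. -/
def jacobiSum (a b : V) (l m n : ℤ) (M : ℕ) : A.Env :=
  ∑ i ∈ Finset.range M, ((-1) ^ i * (Ring.choose l i : ℂ)) •
      (A.envMode a (m + l - i) * A.envMode b (n + i)
        - ((-1 : ℂ) ^ l) • (A.envMode b (n + l - i) * A.envMode a (m + i)))
    - ∑ i ∈ Finset.range M, (Ring.choose m i : ℂ) •
        A.envMode (A.mode a (l + i) b) (m + n - i)

/-- `A.IsJacobi d x` says that `x ∈ Û_d` is the sum of the (convergent) series given by the difference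
of the two sides of the Jacobi identity, for some homogeneous `a`, `b`. -/
def IsJacobi (d : ℤ) (x : complPiece A.envDeg d) : Prop :=
  ∃ (p q : ℕ) (a b : V) (l m n : ℤ), a ∈ A.gr p ∧ b ∈ A.gr q ∧ d = p + q - l - m - n - 2 ∧
    ∀ k : ℤ, ∀ᶠ M in Filter.atTop, ∃ u : A.envDeg d,
      (u : A.Env) = A.jacobiSum a b l m n M ∧ x.1 k = gq A.envDeg k d u

theorem envMode_mem {q : ℕ} {a : V} (ha : a ∈ A.gr q) {i d : ℤ} (h : d = q - i - 1) :
    A.envMode a i ∈ A.envDeg d := by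
  refine Submodule.subset_span ?_
  have := IsMonomial.mul q a ha i 0 1 IsMonomial.one
  rwa [mul_one, add_zero, ← h] at this

/-- The scalar `c ∈ ℂ` as an element of `U_0`. -/
def envScalar (c : ℂ) : A.envDeg 0 :=
  ⟨algebraMap ℂ A.Env c, by
    rw [Algebra.algebraMap_eq_smul_one]
    exact (A.envSpan 0).smul_mem c (Submodule.subset_span IsMonomial.one)⟩

/-- The element `1_[-1]` of `U_0`. -/
def envVac : A.envDeg 0 := ⟨A.envMode A.vac (-1), A.envMode_mem A.vac_mem (by norm_num)⟩

/-- The element `L_0 = ω_[1]` of `U_0`. -/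
def envL0 : A.envDeg 0 := ⟨A.envMode A.omega 1, A.envMode_mem A.omega_mem (by norm_num)⟩

/-- The two-sided ideal of `Û` generated by the Jacobi relations and the relation `1_[-1] = 1`. -/
def jacobiIdeal : TwoSidedIdeal (Compl A.envDeg) :=
  TwoSidedIdeal.span
    ({z | ∃ (d : ℤ) (x : complPiece A.envDeg d), A.IsJacobi d x ∧ z = cof d x} ∪
      {cof 0 (toCompl A.envDeg 0 A.envVac) - 1})

/-- The (finite) universal enveloping algebra `𝒰 = Û / J̄` of `V`, as a graded ring with its seminorm. -/
def univEnv : SeminormedGradedRing.{v} := complQuotRing A.jacobiIdeal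

/-- The image in `𝒰_0` of an element of `U_0`. -/
def toUnivEnv (u : A.envDeg 0) : A.univEnv.deg 0 :=
  quotToDeg A.jacobiIdeal 0 (toCompl A.envDeg 0 u)

/-- The element `L_0` of `𝒰_0`. -/
def opL0 : A.univEnv.deg 0 := A.toUnivEnv A.envL0

/-- The scalar `c ∈ ℂ` as an element of `𝒰_0`. -/
def scalar (c : ℂ) : A.univEnv.deg 0 := A.toUnivEnv (A.envScalar c)

/-- `c` is an eigenvalue of `L_0` on the subspace `Z` of a `𝒰`-module. -/
def IsL0Eigenvalue {M : Type*} [AddCommGroup M] [Module A.univEnv.carrier M]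
    (Z : Submodule A.univEnv.carrier M) (c : ℂ) : Prop :=
  ∃ z ∈ Z, z ≠ 0 ∧
    (A.opL0 : A.univEnv.carrier) • z = (A.scalar c : A.univEnv.carrier) • z

end VertexOperatorAlgebra

end VOA

end ModeAlg

end

/-!
The ring `𝔄_d` acts on `Φ^L(W)_d` through `μ_d`, that is `x ⋆ y = μ_d(x) y`. For
`W = A_0 ⊗ U / N_R^1 U`, so that `𝔄_d` sits in `Φ^L(W)_d`, this says that the kernel of `μ_d`
annihilates `𝔄_d` from the left, so an identity element of `𝔄_d` makes `μ_d` injective. Its image is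
then a two-sided ideal of `A_d` with an identity element, and such an ideal splits off as a direct
factor. For a graded completion, any class modulo `N^{n+1}` is represented by an element of the
original ring, which makes the neighbourhoods almost canonical.

For submodules `Z` of `Φ^L(W)`, suppose that `Z` meets the degree `0` part trivially and let `w` be
the top component, of degree `n`, of some `z ∈ Z`. An element `β` of `U_{-n}` kills the lower
components of `z`, so `β w = β z` lies in `Z` and in degree `0`, hence vanishes. So `𝔄_n` kills `w`;
it contains an element acting as the identity in degree `n`, whence `w = 0`. Thus, by induction on
the degree of the top component, a non-zero `Z` contains a non-zero vector of degree `0`, on which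
`L_0` acts by the scalar `c_W`.
-/

namespace ModeAlg

section ExactSequence

variable {M R S : Type*} [NonUnitalRing M] [NonUnitalRing R] [NonUnitalNonAssocRing S]
  {i : M →ₙ+* R} {π : R →ₙ+* S} {e : M}

theorem commute_map_identity_of_exact (hex : Function.Exact i π) (he : ∀ x, e * x = x ∧ x * e = x)
    (a : R) : Commute a (i e) := by
  obtain ⟨m, hm⟩ : a * i e ∈ Set.range i :=
    (hex _).1 (by rw [map_mul, hex.apply_apply_eq_zero, mul_zero])
  obtain ⟨m', hm'⟩ : i e * a ∈ Set.range i :=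
    (hex _).1 (by rw [map_mul, hex.apply_apply_eq_zero, zero_mul])
  calc a * i e = i (e * m) := by rw [(he m).1, hm]
    _ = i (m' * e) := by rw [map_mul, map_mul, hm, hm', mul_assoc]
    _ = i e * a := by rw [(he m').2, hm']

theorem exists_map_apply_eq_mul_of_exact (hinj : Function.Injective i)
    (hex : Function.Exact i π) (he : ∀ x, e * x = x ∧ x * e = x) :
    ∃ r : R →ₙ+* M, ∀ a, i (r a) = a * i e := by
  have hrange (a : R) : ∃ m, i m = a * i e :=
    (hex _).1 (by rw [map_mul, hex.apply_apply_eq_zero, mul_zero])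
  choose r hr using hrange
  refine ⟨{ toFun := r, map_mul' := fun a b => hinj ?_, map_zero' := hinj ?_,
            map_add' := fun a b => hinj ?_ }, hr⟩
  · have hidem : i e * i e = i e := by rw [← map_mul, (he e).1]
    calc i (r (a * b)) = a * (b * i e * i e) := by rw [hr, mul_assoc b, hidem, mul_assoc]
      _ = a * i e * (b * i e) := by
          rw [(commute_map_identity_of_exact hex he (b * i e)).eq, mul_assoc a]
      _ = i (r a * r b) := by rw [map_mul, hr, hr]
  · rw [hr, map_zero, zero_mul]
  · rw [map_add, hr, hr, hr, add_mul]

theorem exists_ringEquiv_prod_of_exact (hinj : Function.Injective i) (hsurj : Function.Surjective π)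
    (hex : Function.Exact i π) (he : ∀ x, e * x = x ∧ x * e = x) :
    ∃ f : R ≃+* M × S, (∀ x, f (i x) = (x, 0)) ∧ ∀ a, (f a).2 = π a := by
  obtain ⟨r, hr⟩ := exists_map_apply_eq_mul_of_exact hinj hex he
  let f : R →ₙ+* M × S := r.prod π
  have map_i (x : M) : f (i x) = (x, 0) :=
    Prod.ext (hinj (by change i (r (i x)) = i x; rw [hr, ← map_mul, (he x).2]))
      (hex.apply_apply_eq_zero x)
  refine ⟨RingEquiv.ofBijective f ⟨(injective_iff_map_eq_zero f).2 fun a ha => ?_, ?_⟩, map_i,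
    fun _ => rfl⟩
  · obtain ⟨m, rfl⟩ := (hex a).1 (congrArg Prod.snd ha)
    have hm : m = 0 := congrArg Prod.fst ((map_i m).symm.trans ha)
    rw [hm, map_zero]
  · rintro ⟨m, s⟩
    obtain ⟨a, rfl⟩ := hsurj s
    refine ⟨i (m - r a) + a, ?_⟩
    rw [map_add, map_i]
    exact Prod.ext (sub_add_cancel _ _) (zero_add _)

end ExactSequence

/-- A finite product of rings splits off its last factor; this is the ring version of
`Fin.snocEquiv`. -/
def snocRingEquiv {n : ℕ} (R : Fin (n + 1) → Type*) [∀ j, NonUnitalNonAssocSemiring (R j)] :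
    R (Fin.last n) × (∀ j : Fin n, R j.castSucc) ≃+* ∀ j, R j :=
  { Fin.snocEquiv R with
    map_mul' := fun _ _ => by
      ext j
      cases j using Fin.lastCases <;> simp [Fin.snocEquiv]
    map_add' := fun _ _ => by
      ext j
      cases j using Fin.lastCases <;> simp [Fin.snocEquiv] }

namespace SeminormedGradedRing

variable {U : SeminormedGradedRing.{u}}

theorem mul_mem_deg {p q r : ℤ} {x y : U.carrier} (hx : x ∈ U.deg p) (hy : y ∈ U.deg q)
    (h : p + q = r) : x * y ∈ U.deg r :=
  h ▸ SetLike.mul_mem_graded hx hy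

theorem mul_mul_mem_deg_zero {d : ℤ} (α : U.deg d) (u : U.deg 0) (β : U.deg (-d)) :
    (α : U.carrier) * u * β ∈ U.deg 0 :=
  mul_mem_deg (mul_mem_deg α.2 u.2 (add_zero d)) β.2 (add_neg_cancel d)

theorem canonicalNbhd_inf_deg_le_nbhd {n : ℤ} (h : ∀ q ≤ -n, U.deg q ≤ U.nbhd n) (p : ℤ) :
    U.canonicalNbhd n ⊓ U.deg p ≤ U.nbhd n := by
  suffices hcomp : U.canonicalNbhd n ≤ (U.nbhd n).comap ((U.deg p).subtype.comp (U.comp p)) by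
    rintro z ⟨hz, hzp⟩
    simpa only [AddSubgroup.mem_comap, AddMonoidHom.comp_apply, AddSubgroup.subtype_apply,
      comp_of_mem hzp] using hcomp hz
  refine (AddSubgroup.closure_le _).2 ?_
  rintro _ ⟨x, y, j, hj, hy, rfl⟩
  change (U.comp p (x * y) : U.carrier) ∈ U.nbhd n
  rw [comp_right hy x (sub_add_cancel p j)]
  exact U.mul_nbhd _ _ _ _ _ (U.comp (p - j) x).2 (h j hj hy) hy

theorem almostCanonical_iff :
    U.AlmostCanonical ↔ (∀ n, ∀ p ≤ -n, U.deg p ≤ U.nbhd n) ∧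
      ∀ n p, U.nbhd n ⊓ U.deg p ≤ (U.canonicalNbhd n ⊓ U.deg p) ⊔ (U.nbhd (n + 1) ⊓ U.deg p) := by
  refine ⟨fun h => ⟨fun n p hp y hy => ?_, fun n p => (h n p).le⟩, fun ⟨hdeg, hle⟩ n p =>
    (hle n p).antisymm (sup_le (le_inf (canonicalNbhd_inf_deg_le_nbhd (hdeg n) p) inf_le_right)
      (inf_le_inf_right _ (U.nbhd_anti n)))⟩
  have hy' : y ∈ U.canonicalNbhd n :=
    AddSubgroup.subset_closure ⟨1, y, p, hp, hy, (one_mul y).symm⟩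
  exact ((h n p).ge (AddSubgroup.mem_sup_left ⟨hy', hy⟩)).1

theorem AlmostCanonical.deg_le_nbhd (hU : U.AlmostCanonical) {n p : ℤ} (hp : p ≤ -n) :
    U.deg p ≤ U.nbhd n :=
  (almostCanonical_iff.1 hU).1 n p hp

theorem zhuMk_eq_zero_iff {d : ℤ} {u : U.deg 0} :
    U.zhuMk d u = 0 ↔ (u : U.carrier) ∈ U.nbhd (d + 1) :=
  Ideal.Quotient.eq_zero_iff_mem

theorem zhuProj_surjective (d : ℤ) : Function.Surjective (U.zhuProj d) := fun a => by
  obtain ⟨u, rfl⟩ := U.zhuMk_surjective _ a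
  exact ⟨U.zhuMk d u, zhuProj_mk U d u⟩

section PhiLDeg

variable {W : Type w} [AddCommGroup W] [Module (U.Zhu 0) W] {p d : ℤ}

theorem phiLTmul_mem_phiLDeg {α : U.carrier} (hα : α ∈ U.deg d) (m : W) :
    U.phiLTmul α m ∈ U.phiLDeg W d :=
  AddSubgroup.subset_closure ⟨α, hα, m, rfl⟩

theorem phiLDeg_le {H : AddSubgroup (U.PhiL W)} (h : ∀ α ∈ U.deg d, ∀ m, U.phiLTmul α m ∈ H) :
    U.phiLDeg W d ≤ H := by
  refine (AddSubgroup.closure_le _).2 ?_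
  rintro _ ⟨α, hα, m, rfl⟩
  exact h α hα m

theorem smul_mem_phiLDeg {q : ℤ} {γ : U.carrier} (hγ : γ ∈ U.deg p) {y : U.PhiL W}
    (hy : y ∈ U.phiLDeg W d) (h : p + d = q) : γ • y ∈ U.phiLDeg W q :=
  phiLDeg_le (H := (U.phiLDeg W q).comap (DistribSMul.toAddMonoidHom (U.PhiL W) γ))
    (fun _ hα _ => phiLTmul_mem_phiLDeg (mul_mem_deg hγ hα h) _) hy

theorem smul_eq_zero_of_mem_nbhd {u : U.deg 0} (hu : (u : U.carrier) ∈ U.nbhd (d + 1))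
    {y : U.PhiL W} (hy : y ∈ U.phiLDeg W d) : (u : U.carrier) • y = 0 := by
  refine phiLDeg_le (H := (DistribSMul.toAddMonoidHom (U.PhiL W) (u : U.carrier)).ker)
    (fun α hα m => phiLTmul_nbhd ?_ m) hy
  have h := U.nbhd_mul _ _ _ _ _ hu u.2 hα
  rwa [add_sub_cancel_left] at h

instance : Module (U.deg 0) (U.phiLDeg W d) where
  smul u y := ⟨(u : U.carrier) • y, smul_mem_phiLDeg u.2 y.2 (zero_add d)⟩
  one_smul y := Subtype.ext (one_smul U.carrier (y : U.PhiL W))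
  mul_smul u v y := Subtype.ext (mul_smul (u : U.carrier) (v : U.carrier) (y : U.PhiL W))
  smul_zero u := Subtype.ext (smul_zero (u : U.carrier))
  smul_add u y z := Subtype.ext (smul_add (u : U.carrier) (y : U.PhiL W) z)
  add_smul u v y := Subtype.ext (add_smul (u : U.carrier) (v : U.carrier) (y : U.PhiL W))
  zero_smul y := Subtype.ext (zero_smul U.carrier (y : U.PhiL W))

theorem isTorsionBySet_phiLDeg :
    Module.IsTorsionBySet (U.deg 0) (U.phiLDeg W d) (U.zhuIdeal (d + 1)) :=
  fun y u => Subtype.ext (smul_eq_zero_of_mem_nbhd u.2 y.2)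

instance : Module (U.Zhu d) (U.phiLDeg W d) :=
  isTorsionBySet_phiLDeg.module

theorem coe_zhuMk_smul (u : U.deg 0) (y : U.phiLDeg W d) :
    ((U.zhuMk d u • y : U.phiLDeg W d) : U.PhiL W) = (u : U.carrier) • (y : U.PhiL W) := rfl

end PhiLDeg

theorem mtaBideg_le {p q : ℤ} {H : AddSubgroup U.MTA}
    (h : ∀ α ∈ U.deg p, ∀ (u : U.deg 0), ∀ β ∈ U.deg q, U.mtaTmul α (U.zhuMk 0 u) β ∈ H) :
    U.mtaBideg p q ≤ H := by
  refine (AddSubgroup.closure_le _).2 ?_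
  rintro _ ⟨α, hα, a, β, hβ, rfl⟩
  obtain ⟨u, rfl⟩ := U.zhuMk_surjective 0 a
  exact h α hα u β hβ

theorem mtaBideg_le_phiLDeg (p q : ℤ) : U.mtaBideg p q ≤ U.phiLDeg U.PhiRZhu p :=
  mtaBideg_le fun _ hα _ _ _ => phiLTmul_mem_phiLDeg hα _

/-- The generator `α ⊗ [u]_0 ⊗ β` of `𝔄_d`. -/
def mtadTmul {d : ℕ} (α : U.deg d) (u : U.deg 0) (β : U.deg (-d)) : U.MTAd d :=
  ⟨U.mtaTmul α (U.zhuMk 0 u) β, AddSubgroup.subset_closure ⟨_, α.2, _, _, β.2, rfl⟩⟩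

theorem mu_mtadTmul {d : ℕ} (α : U.deg d) (u : U.deg 0) (β : U.deg (-d)) :
    U.mu d (mtadTmul α u β) = U.zhuMk d ⟨α * u * β, mul_mul_mem_deg_zero α u β⟩ :=
  mu_tmul U d α u β _ _

theorem mtad_hom_ext {d : ℕ} {P : Type*} [AddMonoid P] {f g : U.MTAd d →+ P}
    (h : ∀ α u β, f (mtadTmul α u β) = g (mtadTmul α u β)) : f = g := by
  have hle : U.mtaBideg d (-d) ≤ (f.eqLocus g).map (U.mtaBideg d (-d)).subtype :=
    mtaBideg_le fun α hα u β hβ => ⟨mtadTmul ⟨α, hα⟩ u ⟨β, hβ⟩, h _ _ _, rfl⟩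
  ext x
  obtain ⟨y, hy, hyx⟩ := hle x.2
  exact Subtype.ext hyx ▸ hy

section Star

variable {W : Type w} [AddCommGroup W] [Module (U.Zhu 0) W]

theorem star_mtaTmul_eq_smul {d : ℤ} (α : U.carrier) (u : U.deg 0) {β : U.carrier}
    (hβ : β ∈ U.deg (-d)) {y : U.PhiL W} (hy : y ∈ U.phiLDeg W d) :
    star (U.mtaTmul α (U.zhuMk 0 u) β) y = (α * u * β) • y := by
  refine phiLDeg_le (H := (starHom.flip (U.mtaTmul α (U.zhuMk 0 u) β)).eqLocus
    (DistribSMul.toAddMonoidHom (U.PhiL W) (α * u * β))) (fun γ hγ m => ?_) hy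
  have hβγ : (U.comp 0 (β * γ) : U.carrier) = β * γ :=
    comp_of_mem (mul_mem_deg hβ hγ (neg_add_cancel d))
  calc star (U.mtaTmul α (U.zhuMk 0 u) β) (U.phiLTmul γ m)
      = U.phiLTmul α (U.zhuMk 0 (u * U.comp 0 (β * γ)) • m) := by
        rw [star_tmul, ostar, map_mul (U.zhuMk 0), mul_smul]
    _ = (α * u * β) • U.phiLTmul γ m := by
        rw [← phiLTmul_mul, smul_phiLTmul]
        congr 1
        change α * (u * (U.comp 0 (β * γ) : U.carrier)) = _
        simp only [hβγ, mul_assoc]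

theorem star_eq_mu_smul {d : ℕ} (x : U.MTAd d) (y : U.phiLDeg W d) :
    star (x : U.MTA) (y : U.PhiL W) = (U.mu d x • y : U.phiLDeg W d) := by
  refine DFunLike.congr_fun (mtad_hom_ext (f := (starHom (y : U.PhiL W)).comp
    (U.mtaBideg d (-d)).subtype) (g := (U.phiLDeg W d).subtype.comp
      (((smulAddHom (U.Zhu d) (U.phiLDeg W d)).flip y).comp (U.mu d))) fun α u β => ?_) x
  change star (mtadTmul α u β : U.MTA) (y : U.PhiL W) =
    (U.mu d (mtadTmul α u β) • y : U.phiLDeg W d)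
  rw [mu_mtadTmul, coe_zhuMk_smul]
  exact star_mtaTmul_eq_smul _ _ β.2 y.2

end Star

/-- The inclusion of `𝔄_d` in `Φ^L(Φ^R(A_0))_d`, whose target is an `A_d`-module. -/
def mtadToPhiLDeg (d : ℕ) : U.MTAd d →+ U.phiLDeg U.PhiRZhu d :=
  AddSubgroup.inclusion (mtaBideg_le_phiLDeg d (-d))

theorem mtadToPhiLDeg_injective (d : ℕ) : Function.Injective (mtadToPhiLDeg (U := U) d) :=
  AddSubgroup.inclusion_injective (mtaBideg_le_phiLDeg (d : ℤ) (-d))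

theorem mtadToPhiLDeg_mul {d : ℕ} (x y : U.MTAd d) :
    mtadToPhiLDeg d (x * y) = U.mu d x • mtadToPhiLDeg d y :=
  Subtype.ext (star_eq_mu_smul (W := U.PhiRZhu) x (mtadToPhiLDeg d y))

theorem muFull_coe_smul {d : ℤ} (u : U.deg 0) (y : U.PhiL U.PhiRZhu) :
    muFull d ((u : U.carrier) • y) = U.zhuMk d u * muFull d y := by
  refine DFunLike.congr_fun (mta_hom_ext
    (f := (muFull d).comp (DistribSMul.toAddMonoidHom (U.PhiL U.PhiRZhu) (u : U.carrier)))
    (g := (AddMonoidHom.mulLeft (U.zhuMk d u)).comp (muFull d)) fun α a β => ?_) y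
  obtain ⟨v, rfl⟩ := U.zhuMk_surjective 0 a
  have hcomp : U.comp 0 (U.comp d (u * α) * (v * U.comp (-d) β)) =
      u * U.comp 0 (U.comp d α * (v * U.comp (-d) β)) := Subtype.ext <| by
    rw [comp_left u.2 α (zero_add d), mul_assoc, comp_left u.2 _ (zero_add 0)]
    rfl
  exact (congrArg (U.zhuMk d) hcomp).trans (map_mul _ _ _)

theorem mu_mul {d : ℕ} (x y : U.MTAd d) : U.mu d (x * y) = U.mu d x * U.mu d y := by
  obtain ⟨u, hu⟩ := U.zhuMk_surjective d (U.mu d x)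
  calc U.mu d (x * y)
      = muFull (d : ℤ) (mtadToPhiLDeg d (x * y) : U.PhiL U.PhiRZhu) := rfl
    _ = muFull (d : ℤ) ((u : U.carrier) • (mtadToPhiLDeg d y : U.PhiL U.PhiRZhu)) := by
        rw [mtadToPhiLDeg_mul, ← hu, coe_zhuMk_smul]
    _ = U.mu d x * U.mu d y := by rw [muFull_coe_smul, hu]; rfl

theorem mu_injective {d : ℕ} (hd : U.HasIdentity d) : Function.Injective (U.mu d) := by
  obtain ⟨e, he⟩ := hd
  refine (injective_iff_map_eq_zero _).2 fun x hx => mtadToPhiLDeg_injective d ?_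
  calc mtadToPhiLDeg d x = U.mu d x • mtadToPhiLDeg d e := by rw [← mtadToPhiLDeg_mul, (he x).2]
    _ = mtadToPhiLDeg d 0 := by rw [hx, zero_smul, map_zero]

namespace AlmostCanonical

variable (hU : U.AlmostCanonical)
include hU

theorem zhuProj_mu {d : ℕ} (x : U.MTAd d) : U.zhuProj d (U.mu d x) = 0 := by
  refine DFunLike.congr_fun (mtad_hom_ext
    (f := (U.zhuProj d).toAddMonoidHom.comp (U.mu d)) (g := 0) fun α u β => ?_) x
  change U.zhuProj d (U.mu d (mtadTmul α u β)) = 0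
  rw [mu_mtadTmul, zhuProj_mk, zhuMk_eq_zero_iff, sub_add_cancel]
  change (α : U.carrier) * u * β ∈ U.nbhd d
  rw [mul_assoc]
  have huβ : (u : U.carrier) * β ∈ U.deg (-d) := mul_mem_deg u.2 β.2 (zero_add _)
  exact U.mul_nbhd _ _ _ _ _ α.2 (hU.deg_le_nbhd le_rfl huβ) huβ

theorem zhuMk_comp_mem_range_mu {d : ℕ} {z : U.carrier} (hz : z ∈ U.canonicalNbhd d) :
    U.zhuMk d (U.comp 0 z) ∈ (U.mu d).range := by
  suffices h : U.canonicalNbhd d ≤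
      (U.mu d).range.comap ((U.zhuMk d).toAddMonoidHom.comp (U.comp 0)) from h hz
  refine (AddSubgroup.closure_le _).2 ?_
  rintro _ ⟨x, y, j, hj, hy, rfl⟩
  change U.zhuMk d (U.comp 0 (x * y)) ∈ (U.mu d).range
  rcases hj.eq_or_lt with rfl | hlt
  · refine ⟨mtadTmul (U.comp d x) 1 ⟨y, hy⟩, ?_⟩
    rw [mu_mtadTmul]
    congr 1
    ext
    simp [comp_right hy x (add_neg_cancel (d : ℤ))]
  · have hy' : y ∈ U.nbhd (d + 1) := hU.deg_le_nbhd (by lia) hy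
    have hxy : (U.comp 0 (x * y) : U.carrier) ∈ U.nbhd (d + 1) := by
      rw [comp_right hy x (neg_add_cancel j)]
      exact U.mul_nbhd _ _ _ _ _ (U.comp (-j) x).2 hy' hy
    rw [U.zhuMk_eq_zero hxy]
    exact zero_mem _

theorem exact_mu_zhuProj (d : ℕ) : Function.Exact (U.mu d) (U.zhuProj d) := by
  intro a
  refine ⟨fun ha => ?_, by rintro ⟨x, rfl⟩; exact hU.zhuProj_mu x⟩
  obtain ⟨u, rfl⟩ := U.zhuMk_surjective d a
  rw [zhuProj_mk, zhuMk_eq_zero_iff, sub_add_cancel] at ha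
  obtain ⟨v, ⟨hv, hv₀⟩, w, ⟨hw, hw₀⟩, hvw⟩ :=
    AddSubgroup.mem_sup.1 ((almostCanonical_iff.1 hU).2 d 0 ⟨ha, u.2⟩)
  have hu : u = U.comp 0 v + ⟨w, hw₀⟩ := Subtype.ext <| by
    rw [AddSubgroup.coe_add, comp_of_mem hv₀, hvw]
  rw [hu, map_add, U.zhuMk_eq_zero (u := ⟨w, hw₀⟩) hw, add_zero]
  exact hU.zhuMk_comp_mem_range_mu hv

theorem splitsAsProduct {d : ℕ} (hd : U.HasIdentity d) : U.SplitsAsProduct d := by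
  obtain ⟨e, he⟩ := hd
  let i : U.MTAd d →ₙ+* U.Zhu d := { U.mu d with map_mul' := mu_mul }
  let π : U.Zhu d →ₙ+* U.Zhu (d - 1) := U.zhuProj d
  have hex : Function.Exact i π := hU.exact_mu_zhuProj d
  exact exists_ringEquiv_prod_of_exact (mu_injective ⟨e, he⟩) (zhuProj_surjective d) hex he

theorem subsingleton_zhu {d : ℤ} (hd : d < 0) : Subsingleton (U.Zhu d) := by
  refine subsingleton_of_forall_eq 0 fun a => ?_
  obtain ⟨u, rfl⟩ := U.zhuMk_surjective d a
  exact U.zhuMk_eq_zero (hU.deg_le_nbhd (by lia) u.2)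

theorem nonempty_zhu_ringEquiv_pi (n : ℕ) (h : ∀ j < n, U.HasIdentity j) :
    Nonempty (U.Zhu (n - 1) ≃+* ∀ j : Fin n, U.MTAd j) := by
  induction n with
  | zero =>
    have := hU.subsingleton_zhu (d := (0 : ℕ) - 1) (by norm_num)
    have : Unique (U.Zhu ((0 : ℕ) - 1)) := uniqueOfSubsingleton 0
    exact ⟨RingEquiv.ofUnique⟩
  | succ n ih =>
    obtain ⟨f⟩ := ih fun j hj => h j (hj.trans n.lt_succ_self)
    obtain ⟨g, -⟩ := hU.splitsAsProduct (h n n.lt_succ_self)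
    rw [Nat.cast_succ, add_sub_cancel_right]
    exact ⟨g.trans <| ((RingEquiv.refl _).prodCongr f).trans
      (snocRingEquiv fun j : Fin (n + 1) => U.MTAd j)⟩

end AlmostCanonical

section Submodules

variable {W : Type w} [AddCommGroup W] [Module (U.Zhu 0) W]

theorem star_phiLMap {W' : Type*} [AddCommGroup W'] [Module (U.Zhu 0) W']
    (f : W →ₗ[U.Zhu 0] W') (x : U.MTA) (y : U.PhiL W) :
    star x (phiLMap f y) = phiLMap f (star x y) := by
  refine phiL_induction (P := fun y => star x (phiLMap f y) = phiLMap f (star x y)) y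
    (by simp only [map_zero, star_zero]) (fun β m => ?_)
    fun y y' h h' => by simp only [map_add, star_add, h, h']
  refine DFunLike.congr_fun (mta_hom_ext (f := starHom (U.phiLTmul β (f m)))
    (g := (phiLMap f).comp (starHom (U.phiLTmul β m))) fun α a α' => ?_) x
  change U.phiLTmul α (a • (U.ostar α' β • f m)) = U.phiLTmul α (f (a • (U.ostar α' β • m)))
  rw [map_smul, map_smul]

theorem star_eq_self_of_mem_phiLDeg {d : ℤ} {x : U.MTA}
    (hx : ∀ y ∈ U.phiLDeg (U.Zhu 0) d, star x y = y) {y : U.PhiL W} (hy : y ∈ U.phiLDeg W d) :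
    star x y = y := by
  refine phiLDeg_le (H := (starHom.flip x).eqLocus (AddMonoidHom.id (U.PhiL W)))
    (fun α hα m => ?_) hy
  have hα_m : phiLMap (LinearMap.toSpanSingleton (U.Zhu 0) W m) (U.phiLTmul α 1) =
      U.phiLTmul α m := by
    rw [phiLMap_tmul, LinearMap.toSpanSingleton_apply, one_smul]
  calc star x (U.phiLTmul α m)
      = phiLMap (LinearMap.toSpanSingleton (U.Zhu 0) W m) (star x (U.phiLTmul α 1)) := by
        rw [← star_phiLMap, hα_m]
    _ = U.phiLTmul α m := by rw [hx _ (phiLTmul_mem_phiLDeg hα 1), hα_m]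

theorem star_eq_zero_of_forall_smul_eq_zero {p d : ℤ} {x : U.MTA} (hx : x ∈ U.mtaBideg p (-d))
    {y : U.PhiL W} (hy : y ∈ U.phiLDeg W d) (hann : ∀ β ∈ U.deg (-d), β • y = 0) :
    star x y = 0 := by
  refine mtaBideg_le (H := (starHom y).ker) (fun α _ u β hβ => ?_) hx
  calc star (U.mtaTmul α (U.zhuMk 0 u) β) y = (α * u * β) • y := star_mtaTmul_eq_smul α u hβ hy
    _ = 0 := by rw [mul_smul, hann β hβ, smul_zero]

theorem smul_phiLTmul_one (a : U.deg 0) (m : W) :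
    (a : U.carrier) • U.phiLTmul 1 m = U.phiLTmul 1 (U.zhuMk 0 a • m) := by
  rw [smul_phiLTmul, ← phiLTmul_mul, mul_one, one_mul]

theorem exists_phiLTmul_one_eq {y : U.PhiL W} (hy : y ∈ U.phiLDeg W 0) :
    ∃ m : W, U.phiLTmul 1 m = y := by
  refine phiLDeg_le
    (H := (AddMonoidHom.mk' (U.phiLTmul (W := W) 1) (phiLTmul_add_right 1)).range)
    (fun α hα m => ⟨U.zhuMk 0 ⟨α, hα⟩ • m, ?_⟩) hy
  change U.phiLTmul 1 (U.zhuMk 0 ⟨α, hα⟩ • m) = U.phiLTmul α m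
  rw [← phiLTmul_mul, one_mul]

theorem iSup_phiLDeg : ⨆ p, U.phiLDeg W p = ⊤ := by
  refine eq_top_iff.2 fun z _ => phiL_induction z (zero_mem _) (fun α m => ?_) fun _ _ => add_mem
  refine DirectSum.Decomposition.inductionOn U.deg
    (motive := fun α => U.phiLTmul α m ∈ ⨆ p, U.phiLDeg W p) ?_ (fun {p} α => ?_)
    (fun α β hα hβ => ?_) α
  · rw [phiLTmul_zero_left]
    exact zero_mem _
  · exact AddSubgroup.mem_iSup_of_mem p (phiLTmul_mem_phiLDeg α.2 m)
  · rw [phiLTmul_add_left]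
    exact add_mem hα hβ

variable (U W) in
/-- The part `⨁_{0 ≤ i < n} Φ^L(W)_i` of the degree filtration of `Φ^L(W)`. -/
def phiLDegLT (n : ℕ) : AddSubgroup (U.PhiL W) := ⨆ i < n, U.phiLDeg W (i : ℤ)

theorem phiLDegLT_succ (n : ℕ) : U.phiLDegLT W (n + 1) = U.phiLDegLT W n ⊔ U.phiLDeg W n :=
  Nat.iSup_lt_succ _ n

theorem phiLDegLT_mono : Monotone (U.phiLDegLT W) :=
  monotone_nat_of_le_succ fun n => (phiLDegLT_succ n).ge.trans' le_sup_left

section NegDegree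

variable (hneg : ∀ p < 0, U.deg p ≤ U.nbhd 1)
include hneg

theorem phiLDeg_eq_bot_of_neg {p : ℤ} (hp : p < 0) : U.phiLDeg W p = ⊥ :=
  eq_bot_iff.2 <| phiLDeg_le fun _ hα m => phiLTmul_nbhd (hneg p hp hα) m

theorem exists_mem_phiLDegLT (z : U.PhiL W) : ∃ n, z ∈ U.phiLDegLT W n := by
  rw [← AddSubgroup.mem_iSup_of_directed phiLDegLT_mono.directed_le]
  suffices h : ⨆ p, U.phiLDeg W p ≤ ⨆ n, U.phiLDegLT W n from h (iSup_phiLDeg.ge trivial)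
  refine iSup_le fun p => ?_
  rcases lt_or_ge p 0 with hp | hp
  · rw [phiLDeg_eq_bot_of_neg hneg hp]
    exact bot_le
  · lift p to ℕ using hp
    exact le_iSup_of_le (p + 1) ((phiLDegLT_succ p).ge.trans' le_sup_right)

theorem smul_eq_zero_of_mem_phiLDegLT {n : ℕ} {γ : U.carrier} (hγ : γ ∈ U.deg (-n))
    {y : U.PhiL W} (hy : y ∈ U.phiLDegLT W n) : γ • y = 0 := by
  suffices h : U.phiLDegLT W n ≤ (DistribSMul.toAddMonoidHom (U.PhiL W) γ).ker from h hy
  refine iSup₂_le fun i hi y hy => ?_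
  have hγy : γ • y ∈ U.phiLDeg W (-n + i) := smul_mem_phiLDeg hγ hy rfl
  rwa [phiLDeg_eq_bot_of_neg hneg (by lia)] at hγy

theorem eq_zero_of_mem_phiLDegLT (hI : U.HasStrongIdentities)
    {Z : Submodule U.carrier (U.PhiL W)} (hZ : ∀ z ∈ Z, z ∈ U.phiLDeg W 0 → z = 0) (n : ℕ) :
    ∀ z ∈ Z, z ∈ U.phiLDegLT W n → z = 0 := by
  induction n with
  | zero => simp [phiLDegLT]
  | succ n ih =>
    intro z hzZ hz
    obtain ⟨y, hy, w, hw, rfl⟩ := AddSubgroup.mem_sup.1 ((phiLDegLT_succ n).le hz)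
    have hann : ∀ β ∈ U.deg (-n), β • w = 0 := fun β hβ => by
      refine hZ _ ?_ (smul_mem_phiLDeg hβ hw (neg_add_cancel _))
      have hβz : β • (y + w) ∈ Z := Z.smul_mem β hzZ
      rwa [smul_add, smul_eq_zero_of_mem_phiLDegLT hneg hβ hy, zero_add] at hβz
    obtain ⟨e, -, he⟩ := hI n
    have hw0 : w = 0 := (star_eq_self_of_mem_phiLDeg he hw).symm.trans
      (star_eq_zero_of_forall_smul_eq_zero e.2 hw hann)
    rw [hw0, add_zero] at hzZ ⊢
    exact ih y hzZ hy

theorem exists_phiLTmul_one_mem (hI : U.HasStrongIdentities)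
    {Z : Submodule U.carrier (U.PhiL W)} (hZ : Z ≠ ⊥) :
    ∃ m : W, U.phiLTmul 1 m ∈ Z ∧ U.phiLTmul 1 m ≠ 0 := by
  by_contra! hcon
  refine hZ (Z.eq_bot_iff.2 fun z hz => ?_)
  obtain ⟨n, hn⟩ := exists_mem_phiLDegLT hneg z
  refine eq_zero_of_mem_phiLDegLT hneg hI (fun y hy hy₀ => ?_) n z hz hn
  obtain ⟨m, rfl⟩ := exists_phiLTmul_one_eq hy₀
  exact hcon m hy

end NegDegree

end Submodules

end SeminormedGradedRing

section Completion

variable {R : Type u} [Ring R] {𝒜 : ℤ → AddSubgroup R} [SetLike.GradedMonoid 𝒜]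

theorem complNbhd_eq_top {n p : ℤ} (h : p ≤ -n) : complNbhd 𝒜 n p = ⊤ := by
  refine eq_top_iff.2 fun x _ => ?_
  obtain ⟨u, hu⟩ := exists_isRep x n
  rw [mem_complNbhd hu]
  exact AddSubgroup.subset_closure
    ⟨p, h, 1, (sub_self p).symm ▸ SetLike.one_mem_graded 𝒜, u, u.2, (one_mul _).symm⟩

variable (J : TwoSidedIdeal (Compl 𝒜))

theorem quotOf_toCompl_mul {p q r : ℤ} {x y : R} (hx : x ∈ 𝒜 p) (hy : y ∈ 𝒜 q)
    (hpq : p + q = r) (hxy : x * y ∈ 𝒜 r) :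
    quotOf J r (toCompl 𝒜 r ⟨x * y, hxy⟩) =
      quotOf J p (toCompl 𝒜 p ⟨x, hx⟩) * quotOf J q (toCompl 𝒜 q ⟨y, hy⟩) := by
  have h := compl_sigma_ext hpq (x := complMul (toCompl 𝒜 p ⟨x, hx⟩) (toCompl 𝒜 q ⟨y, hy⟩))
    (y := toCompl 𝒜 r ⟨x * y, hxy⟩)
    fun n => ⟨_, _, rfl, (isRep_toCompl _).mul (isRep_toCompl _), isRep_toCompl _⟩
  exact (congrArg (fun z : GradedMonoid fun p => complPiece 𝒜 p => quotOf J z.1 z.2) h.symm).trans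
    (quotOf_mul J _ _).symm

theorem quotOf_toCompl_mem_canonicalNbhd {n p : ℤ} {u : 𝒜 p}
    (hu : (u : R) ∈ gradedNbhd 𝒜 n p) :
    quotOf J p (toCompl 𝒜 p u) ∈ (complQuotRing J).canonicalNbhd n := by
  let φ : 𝒜 p →+ ComplQuot J := (quotOf J p).comp <| AddMonoidHom.mk' (toCompl 𝒜 p) fun _ _ =>
    compl_ext fun n => ⟨_, isRep_toCompl _, (isRep_toCompl _).add (isRep_toCompl _)⟩
  suffices h : gradedNbhd 𝒜 n p ≤
      (((complQuotRing J).canonicalNbhd n).comap φ).map (𝒜 p).subtype by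
    obtain ⟨v, hv, hvu⟩ := h hu
    rwa [Subtype.ext hvu] at hv
  refine (AddSubgroup.closure_le _).2 ?_
  rintro _ ⟨j, hj, x, hx, y, hy, rfl⟩
  have hxy : x * y ∈ 𝒜 p := sub_add_cancel p j ▸ SetLike.mul_mem_graded hx hy
  refine ⟨⟨x * y, hxy⟩, AddSubgroup.subset_closure ?_, rfl⟩
  exact ⟨_, _, j, hj, ⟨_, rfl⟩, quotOf_toCompl_mul J hx hy (sub_add_cancel p j) hxy⟩

theorem exists_eq_quotOf {n p : ℤ} {x : ComplQuot J} (hx : x ∈ quotNbhd J n)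
    (hxp : x ∈ quotDeg J p) : ∃ y ∈ complNbhd 𝒜 n p, x = quotOf J p y := by
  simpa only [DirectSum.decompose_of_mem_same (quotDeg J) hxp] using quotNbhd_homog J n x hx p

theorem almostCanonical_complQuotRing : (complQuotRing J).AlmostCanonical := by
  refine SeminormedGradedRing.almostCanonical_iff.2 ⟨?_, ?_⟩
  · rintro n p hp _ ⟨y, rfl⟩
    exact mem_quotNbhd_of J ((complNbhd_eq_top hp).ge trivial)
  · rintro n p _ ⟨hx, hxp⟩
    obtain ⟨y, hy, rfl⟩ := exists_eq_quotOf J hx hxp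
    obtain ⟨u, hu⟩ := exists_isRep y (n + 1)
    have hun : (u : R) ∈ gradedNbhd 𝒜 n p := (mem_complNbhd (hu.mono (by lia))).1 hy
    have hyu : y - toCompl 𝒜 p u ∈ complNbhd 𝒜 (n + 1) p :=
      (congrArg (· - gq 𝒜 (n + 1) p u) (hu _ le_rfl)).trans (sub_self _)
    rw [← add_sub_cancel (toCompl 𝒜 p u) y, map_add]
    exact AddSubgroup.add_mem_sup ⟨quotOf_toCompl_mem_canonicalNbhd J hun, ⟨_, rfl⟩⟩
      ⟨mem_quotNbhd_of J hyu, ⟨_, rfl⟩⟩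

theorem VertexOperatorAlgebra.almostCanonical_univEnv {V : Type v} [AddCommGroup V] [Module ℂ V]
    (A : VertexOperatorAlgebra V) : A.univEnv.AlmostCanonical :=
  almostCanonical_complQuotRing A.jacobiIdeal

end Completion

end ModeAlg

theorem theorem6p0p1_general (U : ModeAlg.SeminormedGradedRing.{u}) (hU : U.AlmostCanonical) :
    (∀ d : ℕ,
      (Function.Surjective (U.zhuProj d) ∧ Function.Exact (U.mu d) (U.zhuProj d)) ∧
      (U.HasIdentity d → Function.Injective (U.mu d) ∧ U.SplitsAsProduct d) ∧
      ((∀ j ≤ d, U.HasIdentity j) → Nonempty (U.Zhu d ≃+* ∀ j : Fin (d + 1), U.MTAd j))) ∧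
    (U.HasStrongIdentities →
      ∀ (W₀ : Type w) [AddCommGroup W₀] [Module (U.Zhu 0) W₀] (L c : U.deg 0),
        (∀ m : W₀, U.zhuMk 0 L • m = U.zhuMk 0 c • m) →
        ∀ Z : Submodule U.carrier (U.PhiL W₀), Z ≠ ⊥ →
          ∃ z ∈ Z, z ≠ 0 ∧ (L : U.carrier) • z = (c : U.carrier) • z) := by
  refine ⟨fun d => ⟨⟨U.zhuProj_surjective d, hU.exact_mu_zhuProj d⟩,
    fun hd => ⟨U.mu_injective hd, hU.splitsAsProduct hd⟩, fun h => ?_⟩,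
    fun hI W₀ _ _ L c hLc Z hZ => ?_⟩
  · rw [← add_sub_cancel_right (d : ℤ) 1, ← Nat.cast_succ]
    exact hU.nonempty_zhu_ringEquiv_pi (d + 1) fun j hj => h j (Nat.lt_succ_iff.1 hj)
  · obtain ⟨m, hm, hm0⟩ := ModeAlg.SeminormedGradedRing.exists_phiLTmul_one_mem
      (fun p hp => hU.deg_le_nbhd (by lia)) hI hZ
    exact ⟨_, hm, hm0, by rw [U.smul_phiLTmul_one, U.smul_phiLTmul_one, hLc]⟩

theorem theorem6p0p1 :
    -- the abstract splitting theorem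
    (∀ U : ModeAlg.SeminormedGradedRing.{u}, U.AlmostCanonical → ∀ d : ℕ,
      (Function.Surjective (U.zhuProj d) ∧ Function.Exact (U.mu d) (U.zhuProj d)) ∧
      (U.HasIdentity d → Function.Injective (U.mu d) ∧ U.SplitsAsProduct d) ∧
      ((∀ j ≤ d, U.HasIdentity j) → Nonempty (U.Zhu d ≃+* ∀ j : Fin (d + 1), U.MTAd j))) ∧
    -- the case of a vertex operator algebra
    (∀ (V : Type v) [AddCommGroup V] [Module ℂ V] (A : ModeAlg.VertexOperatorAlgebra V),
      (∀ d : ℕ,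
        (Function.Surjective (A.univEnv.zhuProj d) ∧
          Function.Exact (A.univEnv.mu d) (A.univEnv.zhuProj d)) ∧
        (A.univEnv.HasIdentity d →
          Function.Injective (A.univEnv.mu d) ∧ A.univEnv.SplitsAsProduct d) ∧
        ((∀ j ≤ d, A.univEnv.HasIdentity j) →
          Nonempty (A.univEnv.Zhu d ≃+* ∀ j : Fin (d + 1), A.univEnv.MTAd j))) ∧
      (A.univEnv.HasStrongIdentities →
        ∀ (W₀ : Type w) [AddCommGroup W₀] [Module (A.univEnv.Zhu 0) W₀] (c : ℂ),
          (∀ x : W₀, A.univEnv.zhuMk 0 A.opL0 • x = A.univEnv.zhuMk 0 (A.scalar c) • x) →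
          ¬ ∃ Z : Submodule A.univEnv.carrier (A.univEnv.PhiL W₀), Z ≠ ⊥ ∧ Z ≠ ⊤ ∧
            ∀ cZ : ℂ, A.IsL0Eigenvalue Z cZ → ∃ k : ℤ, 0 < k ∧ cZ - c = k)) := by
  refine ⟨fun U hU => (theorem6p0p1_general.{u, w} U hU).1, fun V _ _ A => ?_⟩
  obtain ⟨splitting, eigenvector⟩ := theorem6p0p1_general.{v, w} _ A.almostCanonical_univEnv
  refine ⟨splitting, fun hI W₀ _ _ c hc ⟨Z, hZ, _, hpos⟩ => ?_⟩
  obtain ⟨k, hk, hck⟩ := hpos c (eigenvector hI W₀ A.opL0 (A.scalar c) hc Z hZ)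
  rw [sub_self, eq_comm, Int.cast_eq_zero] at hck
  exact hk.ne' hck
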